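/- Let $\Gamma$ be a connected finite metric graph (loops and multiple edges allowed) whose edges are segments of positive finite length, with the Schrödinger operator $H f=-f''+Vf$ on it, where $V$ is real, bounded and piecewise continuous on each edge. The domain of $H$ consists of the functions $f$ that belong to $H^2(e)$ on every edge $e$, are continuous at the vertices, and satisfy at every vertex $v$ a $\delta$-type condition $\sum_{e\ni v}\frac{df}{dx_e}(v)=\alpha_v f(v)$ with $\alpha_v\in\mathbb R$ (derivatives taken into the edge, away from $v$) or the Dirichlet condition $f(v)=0$ (written $\alpha_v=\infty$). A Dirichlet vertex is understood as cutting the graph at that vertex, and connectedness is understood after this cutting; in particular it is the usual connectedness if the Dirichlet vertices have degree one. A proper $m$-partition $P$ of $\Gamma$ is a set of $m$ distinct points in the interiors of edges of $\Gamma$. Imposing the Dirichlet condition at the points of $P$ separates $\Gamma$ into connected subgraphs $\Gamma_j$; let $\lambda_1(\Gamma_j)$ be the lowest eigenvalue of $H$ on $\Gamma_j$ (with the Dirichlet condition at the partition points and the original conditions at the vertices of $\Gamma$), and put $\Lambda(P)=\max_j\lambda_1(\Gamma_j)$. The $\varepsilon$-neighborhood of $P$ is the set of proper $m$-partitions obtained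 by moving each point of $P$ along its edge by a distance smaller than $\varepsilon$. Theorem. If $P$ is a local minimum of $\Lambda$ on the set of proper $m$-partitions of $\Gamma$, that is, if for some $\varepsilon>0$ we have $\Lambda(P)\le\Lambda(P')$ for every $P'$ in the $\varepsilon$-neighborhood of $P$, then $P$ is an equipartition: $\lambda_1(\Gamma_i)=\lambda_1(\Gamma_j)$ for all $i,j$. -/

import Mathlib

open MeasureTheory Set

/-- A quantum graph with vertices `V` and edges `E` (loops and multiple edges are allowed).
The edge `e` is a segment of positive finite length `hi e - lo e` joining `src e` to `tgt e`,
with arc length coordinate running from `lo e` (at `src e`) to `hi e` (at `tgt e`).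
The Hamiltonian is `f ↦ -f'' + pot f`, with the `δ`-type condition of coefficient `coupling v`
at the vertex `v`; the value `⊤` stands for the Dirichlet condition. -/
structure QuantumGraph (V E : Type*) where
  /-- initial vertex of an edge -/
  src : E → V
  /-- terminal vertex of an edge -/
  tgt : E → V
  /-- coordinate of the initial end -/
  lo : E → ℝ
  /-- coordinate of the terminal end -/
  hi : E → ℝ
  lo_lt_hi : ∀ e, lo e < hi e
  /-- the potential along the edges -/
  pot : E → ℝ → ℝ
  pot_bounded : ∀ e, ∃ M : ℝ, ∀ x ∈ Icc (lo e) (hi e), |pot e x| ≤ M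
  pot_piecewise : ∀ e, ∃ S : Finset ℝ, ContinuousOn (pot e) (Icc (lo e) (hi e) \ (S : Set ℝ))
  /-- the coefficient of the vertex condition -/
  coupling : V → WithTop ℝ

/-- `f` belongs to the Sobolev space `H²(a, b)` with first derivative `f'` and second
derivative `f''`: `f` is `C¹` on `[a, b]`, `f'` is absolutely continuous with a.e. derivative
`f''`, and `f''` is square integrable. -/
structure IsH2 (a b : ℝ) (f f' f'' : ℝ → ℝ) : Prop where
  memLp : MemLp f'' 2 (volume.restrict (Icc a b))
  integral_deriv : ∀ x ∈ Icc a b, f x = f a + ∫ t in a..x, f' t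
  integral_deriv2 : ∀ x ∈ Icc a b, f' x = f' a + ∫ t in a..x, f'' t

namespace QuantumGraph

section

variable {V E : Type*} (G : QuantumGraph V E)

open Classical in
/-- The sum over all edge ends at `v` of the derivatives taken into the edge and away from `v`
(a loop at `v` contributes both of its ends). -/
noncomputable def outgoingSum [Fintype E] (f' : E → ℝ → ℝ) (v : V) : ℝ :=
  ∑ e, ((if G.src e = v then f' e (G.lo e) else 0) +
    (if G.tgt e = v then -f' e (G.hi e) else 0))

/-- `f`, with edgewise first and second derivatives `f'` and `f''`, lies in the domain of the
Hamiltonian: it is `H²` on every edge, continuous at the vertices (`φ` being the vertex values),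
it vanishes at the Dirichlet vertices, and at every other vertex the sum of the outgoing
derivatives is the coupling times the value. -/
def InDomain [Fintype E] (f f' f'' : E → ℝ → ℝ) : Prop :=
  (∀ e, IsH2 (G.lo e) (G.hi e) (f e) (f' e) (f'' e)) ∧
  ∃ φ : V → ℝ,
    (∀ e, f e (G.lo e) = φ (G.src e) ∧ f e (G.hi e) = φ (G.tgt e)) ∧
    (∀ v, G.coupling v = ⊤ → φ v = 0) ∧
    (∀ v (α : ℝ), G.coupling v = (α : WithTop ℝ) → G.outgoingSum f' v = α * φ v)

/-- `μ` is an eigenvalue of the Hamiltonian: some function of the domain that is not zero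
satisfies `-f'' + pot f = μ f`. -/
def IsEigenvalue [Fintype E] (μ : ℝ) : Prop :=
  ∃ f f' f'' : E → ℝ → ℝ, G.InDomain f f' f'' ∧
    (∃ e, ∃ x ∈ Icc (G.lo e) (G.hi e), f e x ≠ 0) ∧
    ∀ e, ∀ᵐ x ∂(volume.restrict (Icc (G.lo e) (G.hi e))),
      -f'' e x + G.pot e x * f e x = μ * f e x

/-- The set of eigenvalues of the Hamiltonian. -/
def eigenvalues [Fintype E] : Set ℝ := {μ | G.IsEigenvalue μ}

/-- The groundstate energy `λ₁`, the lowest eigenvalue. -/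
noncomputable def groundEnergy [Fintype E] : ℝ := sInf G.eigenvalues

/-- Two edges are linked if they share a vertex that does not carry the Dirichlet condition.
(The Dirichlet condition at a vertex is equivalent to cutting the graph there.) -/
def Linked (e e' : E) : Prop :=
  ∃ v, G.coupling v ≠ ⊤ ∧ (G.src e = v ∨ G.tgt e = v) ∧ (G.src e' = v ∨ G.tgt e' = v)

/-- Two edges are equivalent if a finite chain of linked edges joins them. -/
def linkSetoid : Setoid E := Relation.EqvGen.setoid G.Linked

/-- The connected components of the graph cut at its Dirichlet vertices, as classes of edges. -/
abbrev Component : Type _ := Quotient G.linkSetoid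

/-- The graph is connected: any two edges are joined by a chain of linked edges. Isolated
vertices carry no functions and are disregarded. If the Dirichlet vertices have degree one, this
is connectedness of the graph in the usual sense. -/
def Connected : Prop := ∀ e e' : E, G.linkSetoid e e'

/-- The subgraph formed by the edges of one component, with the vertex conditions of `G`.
(Vertices that are ends of no edge of the component become isolated and play no role.) -/
def subgraph (c : G.Component) :
    QuantumGraph V {e : E // (Quotient.mk G.linkSetoid e) = c} where
  src e := G.src e
  tgt e := G.tgt e
  lo e := G.lo e
  hi e := G.hi e
  lo_lt_hi e := G.lo_lt_hi e
  pot e := G.pot e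
  pot_bounded e := G.pot_bounded e
  pot_piecewise e := G.pot_piecewise e
  coupling := G.coupling

end

/-- A proper `m`-partition of `G`: a set of `m` distinct points in the interiors of edges.
The `n e` points on the edge `e` are recorded in increasing order, together with the ends of `e`:
`lo e = t 0 < t 1 < ⋯ < t (n e) < t (n e + 1) = hi e`. -/
structure Partition {V E : Type*} [Fintype E] (G : QuantumGraph V E) (m : ℕ) where
  /-- the number of partition points on an edge -/
  n : E → ℕ
  /-- the partition points on an edge and its two ends, in increasing order -/
  t : (e : E) → Fin (n e + 2) → ℝ
  strictMono : ∀ e, StrictMono (t e)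
  t_zero : ∀ e, t e 0 = G.lo e
  t_last : ∀ e, t e (Fin.last (n e + 1)) = G.hi e
  sum_n : ∑ e, n e = m

namespace Partition

section

variable {V E : Type*} [Fintype E] {G : QuantumGraph V E} {m : ℕ} (P : G.Partition m)

/-- The index set of the partition vertices. -/
abbrev Vertex : Type _ := Σ e : E, Fin (P.n e)

/-- The coordinate of a partition vertex on its edge. -/
def pos (p : P.Vertex) : ℝ := P.t p.1 p.2.succ.castSucc

/-- The segments into which the edges are divided. -/
abbrev Segment : Type _ := Σ e : E, Fin (P.n e + 1)

theorem Icc_subset (s : P.Segment) :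
    Icc (P.t s.1 s.2.castSucc) (P.t s.1 s.2.succ) ⊆ Icc (G.lo s.1) (G.hi s.1) := by
  rw [← P.t_zero, ← P.t_last]
  exact Icc_subset_Icc ((P.strictMono s.1).monotone (Fin.zero_le _))
    ((P.strictMono s.1).monotone (Fin.le_last _))

/-- The graph `G` with the partition vertices introduced on its edges, and the Dirichlet
condition imposed at each of them. -/
def divided : QuantumGraph (V ⊕ P.Vertex) P.Segment where
  src s := Fin.cases (motive := fun _ => V ⊕ P.Vertex)
    (Sum.inl (G.src s.1)) (fun k => Sum.inr ⟨s.1, k⟩) s.2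
  tgt s := Fin.lastCases (motive := fun _ => V ⊕ P.Vertex)
    (Sum.inl (G.tgt s.1)) (fun k => Sum.inr ⟨s.1, k⟩) s.2
  lo s := P.t s.1 s.2.castSucc
  hi s := P.t s.1 s.2.succ
  lo_lt_hi s := P.strictMono s.1 s.2.castSucc_lt_succ
  pot s := G.pot s.1
  pot_bounded s := by
    obtain ⟨M, hM⟩ := G.pot_bounded s.1
    exact ⟨M, fun x hx => hM x (P.Icc_subset s hx)⟩
  pot_piecewise s := by
    obtain ⟨S, hS⟩ := G.pot_piecewise s.1
    exact ⟨S, hS.mono (sdiff_subset_sdiff_left (P.Icc_subset s))⟩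
  coupling := Sum.elim G.coupling (fun _ => ⊤)

/-- The index set of the subgraphs `Γ_j` of the partition. -/
abbrev Part : Type _ := P.divided.Component

open Classical in
/-- The eigenvalues of the subgraph `Γ_j`. -/
noncomputable def partEigenvalues (j : P.Part) : Set ℝ := (P.divided.subgraph j).eigenvalues

open Classical in
/-- The groundstate energy `λ₁(Γ_j)`. -/
noncomputable def partEnergy (j : P.Part) : ℝ := (P.divided.subgraph j).groundEnergy

/-- The energy functional `Λ(P) = max_j λ₁(Γ_j)`; there are finitely many subgraphs. -/
noncomputable def energy : ℝ := ⨆ j : P.Part, P.partEnergy j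

/-- `P` is an equipartition: all its subgraphs have the same lowest eigenvalue. -/
def IsEquipartition : Prop := ∃ μ : ℝ, ∀ j : P.Part, IsLeast (P.partEigenvalues j) μ

/-- `Q` lies in the `ε`-neighborhood of `P`: it is obtained by moving every partition vertex of
`P` along its edge by a distance smaller than `ε`. -/
def IsNear (ε : ℝ) (Q : G.Partition m) : Prop :=
  ∃ σ : P.Vertex ≃ Q.Vertex, ∀ p, (σ p).1 = p.1 ∧ |Q.pos (σ p) - P.pos p| < ε

/-- `P` is a local minimum of `Λ` on the set of proper `m`-partitions. -/
def IsLocalMinEnergy : Prop :=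
  ∃ ε : ℝ, 0 < ε ∧ ∀ Q : G.Partition m, P.IsNear ε Q → P.energy ≤ Q.energy

end

end Partition

end QuantumGraph

/-! Suppose the energies of the parts are not all equal. Since Γ is connected, some partition point
separates a part of maximal energy from a part of smaller energy (`forall_iff_of_connected`). Push
that point slightly into the lower part. The maximal part grows at a Dirichlet end, so its energy
drops strictly (`SameData.groundEnergy_lt`). The other part shrinks, but by upper semicontinuity its
energy stays below the maximum if the move is small (`exists_groundEnergy_lt`). No other part
changes, so the number of maximal parts goes down. The new partition has energy at most Λ(P), hence
exactly Λ(P) by minimality, and it is again a local minimum, with a smaller neighborhood. By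
induction on the number of maximal parts it is an equipartition, yet the part just lowered lies
below the maximum: a contradiction.

Both facts about λ₁ are variational: λ₁ is the attained minimum of the Rayleigh quotient on the H¹
form domain (`isLeast_groundEnergy_and_le`). Existence is the direct method. A function is encoded
by its L² derivatives and its vertex values, the map to continuous functions is compact, and the
parallelogram law makes suitable minimizing sequences Cauchy. A minimizer is a weak solution because
the first variation vanishes; the lemma of du Bois-Reymond then gives H² regularity and the vertex
conditions.

For strict monotonicity, the absolute value of a ground state, extended by zero, is a trial function
on the larger graph that does not raise the quotient. If the energy did not drop, it would be a
nonnegative solution there that vanishes, with its derivative, inside an added piece. Uniqueness for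
the initial value problem makes it zero on that edge. At a vertex where it is zero the outgoing
derivatives are nonnegative with sum zero, so it is zero on the adjacent edges too, and
connectedness spreads this everywhere. For semicontinuity, a small linear correction on each edge
turns a ground state into a trial function on the shortened graph. -/

/-! ### Absolutely continuous and Sobolev functions on an interval -/

/-- `f` is absolutely continuous on `[a, b]` with a.e. derivative `f'`. -/
structure IsAC (a b : ℝ) (f f' : ℝ → ℝ) : Prop where
  integrable : IntervalIntegrable f' volume a b
  integral_deriv : ∀ x ∈ Icc a b, f x = f a + ∫ t in a..x, f' t

/-- `f` belongs to the Sobolev space `H¹(a, b)` with derivative `f'`. -/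
structure IsH1 (a b : ℝ) (f f' : ℝ → ℝ) : Prop where
  memLp : MemLp f' 2 (volume.restrict (Icc a b))
  integral_deriv : ∀ x ∈ Icc a b, f x = f a + ∫ t in a..x, f' t

theorem MeasureTheory.MemLp.intervalIntegrable_Icc {a b : ℝ} {f : ℝ → ℝ} (hab : a ≤ b)
    (hf : MemLp f 2 (volume.restrict (Icc a b))) : IntervalIntegrable f volume a b := by
  rw [intervalIntegrable_iff_integrableOn_Icc_of_le hab]
  exact hf.integrable one_le_two

theorem MeasureTheory.MemLp.intervalIntegrable_mul_Icc {a b : ℝ} {f g : ℝ → ℝ} (hab : a ≤ b)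
    (hf : MemLp f 2 (volume.restrict (Icc a b))) (hg : MemLp g 2 (volume.restrict (Icc a b))) :
    IntervalIntegrable (fun x => f x * g x) volume a b := by
  rw [intervalIntegrable_iff_integrableOn_Icc_of_le hab]
  exact hf.integrable_mul hg

theorem ContinuousOn.memLp_two_Icc {a b : ℝ} {f : ℝ → ℝ} (hf : ContinuousOn f (Icc a b)) :
    MemLp f 2 (volume.restrict (Icc a b)) := by
  obtain ⟨C, hC⟩ := isCompact_Icc.exists_bound_of_continuousOn hf
  refine MemLp.of_bound (hf.aestronglyMeasurable measurableSet_Icc) C ?_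
  exact (ae_restrict_iff' measurableSet_Icc).2 (.of_forall hC)

theorem ae_eq_zero_of_integral_mul_self_eq_zero {a b : ℝ} {f : ℝ → ℝ} (hab : a ≤ b)
    (hf : MemLp f 2 (volume.restrict (Icc a b))) (h : ∫ x in a..b, f x * f x = 0) :
    f =ᵐ[volume.restrict (Icc a b)] 0 := by
  rw [intervalIntegral.integral_of_le hab, ← integral_Icc_eq_integral_Ioc,
    integral_eq_zero_iff_of_nonneg (fun x => mul_self_nonneg _) (hf.integrable_mul hf)] at h
  filter_upwards [h] with x hx
  simpa using hx

namespace IsAC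

variable {a b : ℝ} {f f' g g' : ℝ → ℝ}

theorem intervalIntegrable (hf : IsAC a b f f') {x y : ℝ} (hx : x ∈ Icc a b) (hy : y ∈ Icc a b) :
    IntervalIntegrable f' volume x y := by
  refine hf.integrable.mono_set ?_
  have hab := hx.1.trans hx.2
  rw [uIcc_of_le hab]
  exact uIcc_subset_Icc hx hy

theorem sub_eq (hf : IsAC a b f f') {x y : ℝ} (hx : x ∈ Icc a b) (hy : y ∈ Icc a b) :
    f y - f x = ∫ t in x..y, f' t := by
  have ha : a ∈ Icc a b := left_mem_Icc.2 (hx.1.trans hx.2)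
  rw [hf.integral_deriv x hx, hf.integral_deriv y hy,
    ← intervalIntegral.integral_add_adjacent_intervals (hf.intervalIntegrable ha hx)
      (hf.intervalIntegrable hx hy)]
  ring

theorem mono (hf : IsAC a b f f') {c d : ℝ} (hc : a ≤ c) (hcd : c ≤ d) (hd : d ≤ b) :
    IsAC c d f f' := by
  have hc' : c ∈ Icc a b := ⟨hc, hcd.trans hd⟩
  refine ⟨hf.intervalIntegrable hc' ⟨hc.trans hcd, hd⟩, fun x hx => ?_⟩
  rw [← hf.sub_eq hc' ⟨hc.trans hx.1, hx.2.trans hd⟩]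
  ring

theorem continuousOn (hf : IsAC a b f f') : ContinuousOn f (Icc a b) := by
  have h : ContinuousOn (fun x => f a + ∫ t in a..x, f' t) (Icc a b) := by
    by_cases hab : a ≤ b
    · refine continuousOn_const.add ?_
      have := intervalIntegral.continuousOn_primitive_interval
        (hf.integrable.def'.congr_set_ae (by
          rw [uIoc_of_le hab, uIcc_of_le hab]; exact Ioc_ae_eq_Icc.symm) :
          IntegrableOn f' (uIcc a b) volume)
      rwa [uIcc_of_le hab] at this
    · simp [Icc_eq_empty hab]
  exact h.congr hf.integral_deriv

/-- The product rule is integration by parts for the primitives that represent `f` and `g`. Passing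
to these primitives is needed because `f` and `g` are prescribed only on `[a, b]`, while `deriv`
looks at both sides of a point. -/
theorem mul (hf : IsAC a b f f') (hg : IsAC a b g g') (hab : a ≤ b) :
    IsAC a b (fun x => f x * g x) (fun x => f' x * g x + f x * g' x) := by
  refine ⟨(hf.integrable.mul_continuousOn (by rw [uIcc_of_le hab]; exact hg.continuousOn)).add
    (hg.integrable.continuousOn_mul (by rw [uIcc_of_le hab]; exact hf.continuousOn)), ?_⟩
  intro x hx
  have ha : a ∈ Icc a b := left_mem_Icc.2 hab
  have key : ∀ {f f' : ℝ → ℝ}, IsAC a b f f' →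
      AbsolutelyContinuousOnInterval (fun y => f a + ∫ t in a..y, f' t) a x ∧
      ∀ᵐ y, y ∈ uIoc a x → HasDerivAt (fun y => f a + ∫ t in a..y, f' t) (f' y) y := by
    intro f f' hf
    have hi := hf.intervalIntegrable ha hx
    refine ⟨?_, ?_⟩
    · have h1 := hi.absolutelyContinuousOnInterval_intervalIntegral (c := a) left_mem_uIcc
      have h0 : AbsolutelyContinuousOnInterval (fun _ : ℝ => f a) a x :=
        (LipschitzWith.const (f a)).lipschitzOnWith.absolutelyContinuousOnInterval
      exact h0.add h1
    · filter_upwards [hi.ae_hasDerivAt_integral] with y hy hyx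
      exact (hy (uIoc_subset_uIcc hyx) a left_mem_uIcc).const_add _
  obtain ⟨hF, hF'⟩ := key hf
  obtain ⟨hG, hG'⟩ := key hg
  have h := hF.integral_deriv_mul_eq_sub hG
  simp only [intervalIntegral.integral_same, add_zero] at h
  rw [← hf.integral_deriv x hx, ← hg.integral_deriv x hx] at h
  have h2 : (∫ y in a..x, deriv (fun y => f a + ∫ t in a..y, f' t) y * (g a + ∫ t in a..y, g' t)
      + (f a + ∫ t in a..y, f' t) * deriv (fun y => g a + ∫ t in a..y, g' t) y) =
      ∫ y in a..x, f' y * g y + f y * g' y := by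
    refine intervalIntegral.integral_congr_ae ?_
    filter_upwards [hF', hG'] with y hy hy' hyx
    rw [(hy hyx).deriv, (hy' hyx).deriv]
    have : y ∈ Icc a b := by
      rw [uIoc_of_le hx.1] at hyx
      exact ⟨hyx.1.le, hyx.2.trans hx.2⟩
    rw [← hf.integral_deriv y this, ← hg.integral_deriv y this]
  rw [← h2, h]
  ring

theorem integral_mul (hf : IsAC a b f f') (hg : IsAC a b g g') (hab : a ≤ b) :
    ∫ x in a..b, (f' x * g x + f x * g' x) = f b * g b - f a * g a :=
  ((hf.mul hg hab).sub_eq (left_mem_Icc.2 hab) (right_mem_Icc.2 hab)).symm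

theorem add (hf : IsAC a b f f') (hg : IsAC a b g g') :
    IsAC a b (fun x => f x + g x) (fun x => f' x + g' x) := by
  refine ⟨hf.integrable.add hg.integrable, fun x hx => ?_⟩
  have ha : a ∈ Icc a b := left_mem_Icc.2 (hx.1.trans hx.2)
  rw [intervalIntegral.integral_add (hf.intervalIntegrable ha hx) (hg.intervalIntegrable ha hx),
    hf.integral_deriv x hx, hg.integral_deriv x hx]
  ring

theorem of_hasDerivAt (h : ∀ x, HasDerivAt f (f' x) x) (hc : Continuous f') : IsAC a b f f' := by
  refine ⟨hc.intervalIntegrable _ _, fun x _ => ?_⟩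
  rw [intervalIntegral.integral_eq_sub_of_hasDerivAt (fun y _ => h y) (hc.intervalIntegrable _ _)]
  ring

theorem primitive (hf : IntervalIntegrable f' volume a b) (c : ℝ) :
    IsAC a b (fun x => c + ∫ t in a..x, f' t) f' :=
  ⟨hf, fun x _ => by simp⟩

/-- The absolute value of an absolutely continuous function is absolutely continuous, and its
derivative is not larger. -/
theorem abs (hf : IsAC a b f f') (hab : a ≤ b) :
    ∃ k : ℝ → ℝ, Measurable k ∧ IsAC a b (fun x => |f x|) k ∧
      ∀ᵐ x ∂(volume.restrict (Icc a b)), |k x| ≤ |f' x| := by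
  set F : ℝ → ℝ := fun x => f a + ∫ t in a..x, f' t with hF
  have hFf : ∀ x ∈ Icc a b, f x = F x := hf.integral_deriv
  have hFa : AbsolutelyContinuousOnInterval F a b := by
    have h1 := hf.integrable.absolutelyContinuousOnInterval_intervalIntegral (c := a) left_mem_uIcc
    have h0 : AbsolutelyContinuousOnInterval (fun _ : ℝ => f a) a b :=
      (LipschitzWith.const (f a)).lipschitzOnWith.absolutelyContinuousOnInterval
    exact h0.add h1
  have hA : AbsolutelyContinuousOnInterval (fun x => |F x|) a b := by
    rw [absolutelyContinuousOnInterval_iff] at hFa ⊢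
    intro ε hε
    obtain ⟨δ, hδ, h⟩ := hFa ε hε
    refine ⟨δ, hδ, fun I hI hI' => lt_of_le_of_lt (Finset.sum_le_sum fun i _ => ?_) (h I hI hI')⟩
    exact abs_abs_sub_abs_le_abs_sub _ _
  refine ⟨deriv (fun x => |F x|), measurable_deriv _, ⟨hA.intervalIntegrable_deriv, ?_⟩, ?_⟩
  · intro x hx
    have hA' : AbsolutelyContinuousOnInterval (fun x => |F x|) a x :=
      hA.mono (by rw [uIcc_of_le hx.1, uIcc_of_le hab]; exact Icc_subset_Icc_right hx.2)
    rw [hA'.integral_deriv_eq_sub, hFf x hx, hFf a (left_mem_Icc.2 hab)]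
    ring
  · rw [ae_restrict_iff' measurableSet_Icc]
    filter_upwards [hf.integrable.ae_hasDerivAt_integral] with x hx hxab
    have hd : HasDerivAt F (f' x) x :=
      (hx (by rwa [uIcc_of_le hab]) a left_mem_uIcc).const_add _
    rcases eq_or_ne (F x) 0 with h0 | h0
    -- A zero of `F` is a minimum of `|F|`, so `deriv` is zero there, whether as a true derivative
    -- or as the default value.
    · have : IsLocalMin (fun x => |F x|) x := .of_forall fun y => by simp [h0]
      rw [this.deriv_eq_zero]
      simp
    · rcases h0.lt_or_gt with h0 | h0
      · have : HasDerivAt (fun x => |F x|) (-f' x) x := by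
          refine hd.neg.congr_of_eventuallyEq ?_
          filter_upwards [hd.continuousAt.eventually (gt_mem_nhds h0)] with y hy
          exact abs_of_neg hy
        rw [this.deriv, abs_neg]
      · have : HasDerivAt (fun x => |F x|) (f' x) x := by
          refine hd.congr_of_eventuallyEq ?_
          filter_upwards [hd.continuousAt.eventually (lt_mem_nhds h0)] with y hy
          exact abs_of_pos hy
        rw [this.deriv]

/-- A solution of a linear second order equation with bounded coefficients that vanishes to first
order at a point is zero. -/
theorem eq_zero_of_eq_zero_at {u u' u'' : ℝ → ℝ} (hu : IsAC a b u u') (hu' : IsAC a b u' u'')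
    {K : ℝ} (hK : ∀ᵐ x ∂(volume.restrict (Icc a b)), |u'' x| ≤ K * |u x|)
    {x₀ : ℝ} (hx₀ : x₀ ∈ Icc a b) (h0 : u x₀ = 0) (h0' : u' x₀ = 0) :
    ∀ x ∈ Icc a b, u x = 0 ∧ u' x = 0 := by
  set C := 1 + |K|
  have hab := hx₀.1.trans hx₀.2
  -- Gronwall argument for the energy `u² + u'²`, whose derivative is at most `C` times itself in
  -- absolute value. Weighted by `exp (-C t)` it cannot increase to the right of `x₀`; weighted by
  -- `exp (C t)` it cannot decrease on the way up to `x₀`.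
  have hy := (hu.mul hu hab).add (hu'.mul hu' hab)
  have hexp : ∀ c : ℝ, IsAC a b (fun x => Real.exp (c * x)) (fun x => Real.exp (c * x) * c) :=
    fun c => of_hasDerivAt (fun x => by
      simpa using ((hasDerivAt_id x).const_mul c).exp) (by fun_prop)
  have bound : ∀ᵐ x, x ∈ Icc a b → |(u' x * u x + u x * u' x) + (u'' x * u' x + u' x * u'' x)| ≤
      C * (u x * u x + u' x * u' x) := by
    rw [ae_restrict_iff' measurableSet_Icc] at hK
    filter_upwards [hK] with x hx hxab
    have h1 := hx hxab
    have h2 : |u'' x| ≤ |K| * |u x| := h1.trans (by gcongr; exact le_abs_self K)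
    have h3 : |u x| * |u' x| * 2 ≤ u x * u x + u' x * u' x := by
      nlinarith [sq_nonneg (|u x| - |u' x|), abs_mul_abs_self (u x), abs_mul_abs_self (u' x)]
    calc _ ≤ 2 * (|u x| * |u' x|) + 2 * (|u'' x| * |u' x|) := by
          refine (abs_add_le _ _).trans ?_
          rw [show u' x * u x + u x * u' x = 2 * (u x * u' x) by ring,
            show u'' x * u' x + u' x * u'' x = 2 * (u'' x * u' x) by ring]
          simp [abs_mul]
      _ ≤ 2 * (|u x| * |u' x|) + 2 * ((|K| * |u x|) * |u' x|) := by gcongr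
      _ = C * (|u x| * |u' x| * 2) := by ring
      _ ≤ _ := by gcongr
  have concl : ∀ x, u x * u x + u' x * u' x ≤ 0 → u x = 0 ∧ u' x = 0 := fun x hx =>
    ⟨by nlinarith [mul_self_nonneg (u x), mul_self_nonneg (u' x)],
      by nlinarith [mul_self_nonneg (u x), mul_self_nonneg (u' x)]⟩
  intro x hx
  refine concl x ?_
  rcases le_total x₀ x with hle | hle
  · have h := (hy.mul (hexp (-C)) hab).sub_eq hx₀ hx
    have hneg : (∫ t in x₀..x, ((u' t * u t + u t * u' t) + (u'' t * u' t + u' t * u'' t)) *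
        Real.exp (-C * t) + (u t * u t + u' t * u' t) * (Real.exp (-C * t) * -C)) ≤ 0 := by
      rw [intervalIntegral.integral_of_le hle]
      refine integral_nonpos_of_ae ?_
      rw [Filter.EventuallyLE, ae_restrict_iff' measurableSet_Ioc]
      filter_upwards [bound] with t ht htI
      have := (abs_le.1 (ht ⟨hx₀.1.trans htI.1.le, htI.2.trans hx.2⟩)).2
      have hp := Real.exp_pos (-C * t)
      simp only [Pi.zero_apply]
      nlinarith
    simp only [h0, h0'] at h
    have hp := Real.exp_pos (-C * x)
    by_contra hcon
    push Not at hcon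
    nlinarith [mul_pos hcon hp]
  · have h := (hy.mul (hexp C) hab).sub_eq hx hx₀
    have hpos : 0 ≤ (∫ t in x..x₀, ((u' t * u t + u t * u' t) + (u'' t * u' t + u' t * u'' t)) *
        Real.exp (C * t) + (u t * u t + u' t * u' t) * (Real.exp (C * t) * C)) := by
      rw [intervalIntegral.integral_of_le hle]
      refine integral_nonneg_of_ae ?_
      rw [Filter.EventuallyLE, ae_restrict_iff' measurableSet_Ioc]
      filter_upwards [bound] with t ht htI
      have := (abs_le.1 (ht ⟨hx.1.trans htI.1.le, htI.2.trans hx₀.2⟩)).1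
      have hp := Real.exp_pos (C * t)
      simp only [Pi.zero_apply]
      nlinarith
    simp only [h0, h0'] at h
    have hp := Real.exp_pos (C * x)
    by_contra hcon
    push Not at hcon
    nlinarith [mul_pos hcon hp]

end IsAC

namespace IsH1

variable {a b : ℝ} {f f' g g' : ℝ → ℝ}

theorem isAC (hf : IsH1 a b f f') (hab : a ≤ b) : IsAC a b f f' :=
  ⟨hf.memLp.intervalIntegrable_Icc hab, hf.integral_deriv⟩

theorem continuousOn (hf : IsH1 a b f f') : ContinuousOn f (Icc a b) := by
  by_cases hab : a ≤ b
  · exact (hf.isAC hab).continuousOn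
  · simp [Icc_eq_empty hab]

theorem add (hf : IsH1 a b f f') (hg : IsH1 a b g g') :
    IsH1 a b (fun x => f x + g x) (fun x => f' x + g' x) :=
  ⟨hf.memLp.add hg.memLp, fun x hx => by
    have hab := hx.1.trans hx.2
    exact ((hf.isAC hab).add (hg.isAC hab)).integral_deriv x hx⟩

theorem const_mul (hf : IsH1 a b f f') (c : ℝ) :
    IsH1 a b (fun x => c * f x) (fun x => c * f' x) :=
  ⟨hf.memLp.const_mul c, fun x hx => by
    rw [intervalIntegral.integral_const_mul, hf.integral_deriv x hx]
    ring⟩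

theorem of_hasDerivAt (h : ∀ x, HasDerivAt f (f' x) x) (hc : Continuous f') : IsH1 a b f f' :=
  ⟨hc.continuousOn.memLp_two_Icc, (IsAC.of_hasDerivAt h hc).integral_deriv⟩

theorem linear (p q c : ℝ) : IsH1 a b (fun x => p + q * (x - c)) (fun _ => q) :=
  of_hasDerivAt (fun x => by
    simpa using (((hasDerivAt_id x).sub_const c).const_mul q).const_add p) continuous_const

theorem mono (hf : IsH1 a b f f') {c d : ℝ} (hc : a ≤ c) (hd : d ≤ b) :
    IsH1 c d f f' := by
  refine ⟨hf.memLp.mono_measure (Measure.restrict_mono (Icc_subset_Icc hc hd) le_rfl), ?_⟩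
  intro x hx
  have hcd := hx.1.trans hx.2
  exact ((hf.isAC (hc.trans (hcd.trans hd))).mono hc hcd hd).integral_deriv x hx

theorem abs (hf : IsH1 a b f f') (hab : a ≤ b) :
    ∃ k : ℝ → ℝ, IsH1 a b (fun x => |f x|) k ∧
      ∀ᵐ x ∂(volume.restrict (Icc a b)), |k x| ≤ |f' x| := by
  obtain ⟨k, hk, h, hle⟩ := (hf.isAC hab).abs hab
  exact ⟨k, ⟨hf.memLp.mono hk.aestronglyMeasurable hle, h.integral_deriv⟩, hle⟩

/-- Extension by zero. -/
theorem indicator (hf : IsH1 a b f f') (hab : a ≤ b) {c d : ℝ} (hc : c ≤ a) (hd : b ≤ d)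
    (ha : c < a → f a = 0) (hb : b < d → f b = 0) :
    IsH1 c d ((Icc a b).indicator f) ((Icc a b).indicator f') := by
  have hsub : Icc a b ⊆ Icc c d := Icc_subset_Icc hc hd
  refine ⟨?_, fun x hx => ?_⟩
  · rw [memLp_indicator_iff_restrict measurableSet_Icc, Measure.restrict_restrict measurableSet_Icc,
      inter_eq_left.2 hsub]
    exact hf.memLp
  have hc0 : (Icc a b).indicator f c = if c = a then f a else 0 := by
    split_ifs with h
    · rw [h, indicator_of_mem (left_mem_Icc.2 hab)]
    · rw [indicator_of_notMem fun h' => h (le_antisymm hc h'.1)]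
  have hfa : (if c = a then f a else 0) = f a := by
    split_ifs with h
    · rfl
    · exact (ha (lt_of_le_of_ne hc h)).symm
  rw [hc0, hfa, intervalIntegral.integral_of_le hx.1, setIntegral_indicator measurableSet_Icc]
  rcases lt_or_ge x a with hxa | hxa
  · have : Ioc c x ∩ Icc a b = ∅ := by
      ext y; simp only [mem_inter_iff, mem_Ioc, mem_Icc, mem_empty_iff_false, iff_false]
      intro h; linarith [h.1.2, h.2.1]
    rw [this, indicator_of_notMem fun h => hxa.not_ge h.1, ha (lt_of_le_of_lt hx.1 hxa)]
    simp
  · have hset : ∀ y, y = min x b → (∫ t in Ioc c x ∩ Icc a b, f' t) = ∫ t in a..y, f' t := by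
      intro y hy
      have hay : a ≤ y := hy ▸ le_min hxa hab
      rw [intervalIntegral.integral_of_le hay]
      refine setIntegral_congr_set ?_
      have h1 : (Ioc c x ∩ Icc a b : Set ℝ) =ᵐ[volume] (Icc c x ∩ Icc a b : Set ℝ) :=
        Ioc_ae_eq_Icc.inter (ae_eq_refl _)
      refine h1.trans ?_
      rw [Icc_inter_Icc, sup_eq_right.2 hc]
      subst hy
      exact Ioc_ae_eq_Icc.symm
    rw [hset _ rfl]
    rcases le_or_gt x b with hxb | hxb
    · rw [min_eq_left hxb, indicator_of_mem (show x ∈ Icc a b from ⟨hxa, hxb⟩)]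
      exact hf.integral_deriv x ⟨hxa, hxb⟩
    · rw [min_eq_right hxb.le, indicator_of_notMem fun h => hxb.not_ge h.2,
        ← hf.integral_deriv b (right_mem_Icc.2 hab), hb (hxb.trans_le hx.2)]

/-- The lemma of du Bois-Reymond. -/
theorem exists_ae_eq_primitive (hf : IsH1 a b f f') (hab : a < b) {w : ℝ → ℝ}
    (hw : IntervalIntegrable w volume a b)
    (h : ∀ g g' : ℝ → ℝ, IsH1 a b g g' → g a = 0 → g b = 0 →
      ∫ x in a..b, (f' x * g' x + w x * g x) = 0) :
    ∃ c : ℝ, f' =ᵐ[volume.restrict (Icc a b)] fun x => c + ∫ t in a..x, w t := by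
  set W : ℝ → ℝ := fun x => 0 + ∫ t in a..x, w t with hW
  have hWac : IsAC a b W w := IsAC.primitive hw 0
  have hWm : MemLp W 2 (volume.restrict (Icc a b)) := hWac.continuousOn.memLp_two_Icc
  -- The mean of `f' - W`: after subtracting it, `k` has integral zero, so its primitive `g`
  -- vanishes at both ends and is an admissible test function. Testing with `g` gives `∫ k² = 0`.
  set c : ℝ := (b - a)⁻¹ * ∫ x in a..b, (f' x - W x) with hc
  have hcm : MemLp (fun _ : ℝ => c) 2 (volume.restrict (Icc a b)) := memLp_const c
  set k : ℝ → ℝ := fun x => f' x - W x - c with hk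
  have hkm : MemLp k 2 (volume.restrict (Icc a b)) := (hf.memLp.sub hWm).sub hcm
  set g : ℝ → ℝ := fun x => 0 + ∫ t in a..x, k t with hg
  have hgH : IsH1 a b g k := ⟨hkm, fun x _ => by simp [hg]⟩
  have hfi := hf.memLp.intervalIntegrable_Icc hab.le
  have hWi := hWm.intervalIntegrable_Icc hab.le
  have hki := hkm.intervalIntegrable_Icc hab.le
  have hk0 : ∫ x in a..b, k x = 0 := by
    rw [hk, intervalIntegral.integral_sub (hfi.sub hWi) intervalIntegrable_const,
      intervalIntegral.integral_const, hc, smul_eq_mul, ← mul_assoc,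
      mul_inv_cancel₀ (sub_ne_zero.2 hab.ne'), one_mul, sub_self]
  have hga : g a = 0 := by simp [hg]
  have hgb : g b = 0 := by simp [hg, hk0]
  have h1 := h g k hgH hga hgb
  have h2 := hWac.integral_mul (hgH.isAC hab.le) hab.le
  rw [hga, hgb, mul_zero, mul_zero, sub_zero] at h2
  have hfk := hf.memLp.intervalIntegrable_mul_Icc hab.le hkm
  have hWk := hWm.intervalIntegrable_mul_Icc hab.le hkm
  have hwg : IntervalIntegrable (fun x => w x * g x) volume a b :=
    hw.mul_continuousOn (by rw [uIcc_of_le hab.le]; exact hgH.continuousOn)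
  have h3 : ∫ x in a..b, k x * k x = 0 := by
    have : ∀ x, k x * k x =
        ((f' x * k x + w x * g x) - (w x * g x + W x * k x)) - c * k x := by
      intro x; simp only [hk]; ring
    simp_rw [this]
    rw [intervalIntegral.integral_sub ((hfk.add hwg).sub (hwg.add hWk)) (hki.const_mul c),
      intervalIntegral.integral_sub (hfk.add hwg) (hwg.add hWk), h1, h2,
      intervalIntegral.integral_const_mul, hk0]
    simp
  refine ⟨c, ?_⟩
  filter_upwards [ae_eq_zero_of_integral_mul_self_eq_zero hab.le hkm h3] with x hx
  simp only [hk, hW, Pi.zero_apply] at hx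
  linarith

end IsH1

namespace IsH2

variable {a b : ℝ} {f f' f'' : ℝ → ℝ}

theorem isH1_deriv (h : IsH2 a b f f' f'') : IsH1 a b f' f'' := ⟨h.memLp, h.integral_deriv2⟩

theorem isH1 (h : IsH2 a b f f' f'') : IsH1 a b f f' :=
  ⟨h.isH1_deriv.continuousOn.memLp_two_Icc, h.integral_deriv⟩

end IsH2

/-! ### Minimizing a Rayleigh quotient by compactness and the parallelogram law -/

section Minimizer

open Filter Topology

variable {X Z : Type*} [NormedAddCommGroup X] [NormedSpace ℝ X]
  [NormedAddCommGroup Z] [NormedSpace ℝ Z]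

/-- A Gårding inequality up to a compact term holds up to the weaker term `ν ∘ J`. -/
theorem exists_garding {h : X → ℝ} {ν : Z → ℝ} (J : X →L[ℝ] Z)
    (h_smul : ∀ (t : ℝ) x, h (t • x) = t ^ 2 * h x)
    (ν_cont : Continuous ν) (ν_smul : ∀ (t : ℝ) z, ν (t • z) = t ^ 2 * ν z)
    (ν_pos : ∀ z ≠ 0, 0 < ν z)
    {c C : ℝ} (hc : 0 < c) (garding : ∀ x, c * ‖x‖ ^ 2 ≤ h x + C * ‖J x‖ ^ 2)
    (compact : ∀ R : ℝ, ∃ K : Set Z, IsCompact K ∧ ∀ x, ‖x‖ ≤ R → J x ∈ K) :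
    ∃ K : ℝ, ∀ x, c / 2 * ‖x‖ ^ 2 ≤ h x + K * ν (J x) := by
  have ν_nonneg : ∀ z, 0 ≤ ν z := fun z => by
    rcases eq_or_ne z 0 with rfl | hz
    · have := ν_smul 0 0
      simp at this
      exact this.ge
    · exact (ν_pos z hz).le
  suffices H : ∃ n : ℕ, ∀ x, ‖x‖ = 1 → c / 2 ≤ h x + n * ν (J x) by
    obtain ⟨n, hn⟩ := H
    refine ⟨n, fun x => ?_⟩
    rcases eq_or_ne x 0 with rfl | hx
    · have h0 := h_smul 0 0
      have ν0 := ν_smul 0 0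
      simp at h0 ν0
      simp [h0, ν0]
    · have hx' : 0 < ‖x‖ := norm_pos_iff.2 hx
      have := hn (‖x‖⁻¹ • x) (by rw [norm_smul, norm_inv, norm_norm, inv_mul_cancel₀ hx'.ne'])
      rw [h_smul, map_smul, ν_smul] at this
      have h2 := mul_le_mul_of_nonneg_right this (sq_nonneg ‖x‖)
      have h3 : (‖x‖⁻¹ ^ 2 * h x + n * (‖x‖⁻¹ ^ 2 * ν (J x))) * ‖x‖ ^ 2 = h x + n * ν (J x) := by
        field_simp
      rwa [h3] at h2
  -- Unit vectors that violate the bound for every `n` have, along a subsequence, images `J x`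
  -- converging to some `z`. Boundedness of `n * ν (J x)` forces `ν z = 0`, so `z = 0`, while the
  -- Gårding inequality keeps `C * ‖z‖ ^ 2` above `c / 2`.
  by_contra hcon
  push Not at hcon
  choose x hx1 hx using hcon
  obtain ⟨K, hK, hKJ⟩ := compact 1
  obtain ⟨z, -, φ, hφ, hz⟩ := hK.tendsto_subseq fun n => hKJ (x n) (hx1 n).le
  have hz : Tendsto (fun n => J (x (φ n))) atTop (𝓝 z) := hz
  have hb : ∀ n, c ≤ h (x n) + C * ‖J (x n)‖ ^ 2 := fun n => by
    simpa [hx1 n] using garding (x n)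
  have hlim : Tendsto (fun n => C * ‖J (x (φ n))‖ ^ 2) atTop (𝓝 (C * ‖z‖ ^ 2)) :=
    (hz.norm.pow 2).const_mul C
  have hν : Tendsto (fun n => ν (J (x (φ n)))) atTop (𝓝 0) := by
    have h1 : Tendsto (fun n => (C * ‖J (x (φ n))‖ ^ 2 - c / 2) * (φ n : ℝ)⁻¹) atTop
        (𝓝 ((C * ‖z‖ ^ 2 - c / 2) * 0)) :=
      (hlim.sub_const _).mul
        ((tendsto_inv_atTop_zero.comp tendsto_natCast_atTop_atTop).comp hφ.tendsto_atTop)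
    rw [mul_zero] at h1
    refine squeeze_zero' (.of_forall fun n => ν_nonneg _) ?_ h1
    filter_upwards [eventually_gt_atTop 0] with n hn
    have hpos : (0 : ℝ) < φ n := by exact_mod_cast hn.trans_le (hφ.id_le n)
    rw [← div_eq_mul_inv, le_div_iff₀ hpos]
    linarith [hx (φ n), hb (φ n)]
  have hνz : ν z = 0 := tendsto_nhds_unique ((ν_cont.tendsto z).comp hz) hν
  have hz0 : z = 0 := by
    by_contra hne
    exact (ν_pos z hne).ne' hνz
  have : c / 2 ≤ C * ‖z‖ ^ 2 := ge_of_tendsto' hlim fun n => by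
    have := mul_nonneg (φ n).cast_nonneg (ν_nonneg (J (x (φ n))))
    linarith [hx (φ n), hb (φ n)]
  simp [hz0] at this
  linarith

/-- The Rayleigh quotient of a coercive quadratic form with respect to a compact one attains its
minimum. -/
theorem exists_rayleigh_minimizer [CompleteSpace X] [Nontrivial X] {h : X → ℝ} {ν : Z → ℝ}
    (J : X →L[ℝ] Z) (J_inj : ∀ x, J x = 0 → x = 0)
    (h_cont : Continuous h) (h_smul : ∀ (t : ℝ) x, h (t • x) = t ^ 2 * h x)
    (h_par : ∀ x y, h (x + y) + h (x - y) = 2 * h x + 2 * h y)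
    (ν_cont : Continuous ν) (ν_smul : ∀ (t : ℝ) z, ν (t • z) = t ^ 2 * ν z)
    (ν_par : ∀ x y, ν (x + y) + ν (x - y) = 2 * ν x + 2 * ν y)
    (ν_pos : ∀ z ≠ 0, 0 < ν z)
    {c C : ℝ} (hc : 0 < c) (garding : ∀ x, c * ‖x‖ ^ 2 ≤ h x + C * ‖J x‖ ^ 2)
    (compact : ∀ R : ℝ, ∃ K : Set Z, IsCompact K ∧ ∀ x, ‖x‖ ≤ R → J x ∈ K) :
    ∃ x, x ≠ 0 ∧ ∀ y, h x * ν (J y) ≤ h y * ν (J x) := by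
  obtain ⟨K, hK⟩ := exists_garding J h_smul ν_cont ν_smul ν_pos hc garding compact
  have νJ_pos : ∀ x, x ≠ 0 → 0 < ν (J x) := fun x hx => ν_pos _ fun h0 => hx (J_inj x h0)
  have normalize : ∀ x, x ≠ 0 → ∃ t : ℝ, t ^ 2 * ν (J x) = 1 := fun x hx =>
    ⟨(√(ν (J x)))⁻¹, by
      rw [inv_pow, Real.sq_sqrt (νJ_pos x hx).le, inv_mul_cancel₀ (νJ_pos x hx).ne']⟩
  set S : Set ℝ := {r | ∃ x, ν (J x) = 1 ∧ h x = r} with hS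
  have hne : S.Nonempty := by
    obtain ⟨x, hx⟩ := exists_ne (0 : X)
    obtain ⟨t, ht⟩ := normalize x hx
    exact ⟨_, t • x, by rw [map_smul, ν_smul, ht], rfl⟩
  have hbdd : BddBelow S := by
    refine ⟨-K, ?_⟩
    rintro _ ⟨x, hx, rfl⟩
    have := hK x
    rw [hx] at this
    nlinarith [sq_nonneg ‖x‖]
  set μ := sInf S
  have hμ : ∀ y, μ * ν (J y) ≤ h y := by
    intro y
    rcases eq_or_ne y 0 with rfl | hy
    · have h0 := h_smul 0 0
      have ν0 := ν_smul 0 0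
      simp at h0 ν0
      simp [h0, ν0]
    · obtain ⟨t, ht⟩ := normalize y hy
      have h1 : μ ≤ h (t • y) := csInf_le hbdd ⟨t • y, by rw [map_smul, ν_smul, ht], rfl⟩
      rw [h_smul] at h1
      have h2 := νJ_pos y hy
      calc μ * ν (J y) ≤ t ^ 2 * h y * ν (J y) := by gcongr
        _ = (t ^ 2 * ν (J y)) * h y := by ring
        _ = h y := by rw [ht, one_mul]
  obtain ⟨r, -, hr, hrS⟩ := exists_seq_tendsto_sInf hne hbdd
  choose x hx1 hxr using hrS
  have hhx : Tendsto (fun n => h (x n)) atTop (𝓝 μ) := by simpa only [hxr] using hr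
  obtain ⟨D, hD⟩ := hr.bddAbove_range
  have hbd : ∀ n, ‖x n‖ ≤ √((D + K) / (c / 2)) := fun n => by
    refine Real.le_sqrt_of_sq_le ?_
    rw [le_div_iff₀ (half_pos hc)]
    have := hK (x n)
    rw [hx1, hxr] at this
    linarith [hD (mem_range_self n)]
  obtain ⟨A, hA, hAJ⟩ := compact (√((D + K) / (c / 2)))
  obtain ⟨z, -, φ, hφ, hz⟩ := hA.tendsto_subseq fun n => hAJ (x n) (hbd n)
  have hhφ : Tendsto (fun n => h (x (φ n))) atTop (𝓝 μ) := hhx.comp hφ.tendsto_atTop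
  have hν : Tendsto (fun p : ℕ × ℕ => ν (J (x (φ p.1)) - J (x (φ p.2)))) (atTop ×ˢ atTop)
      (𝓝 (ν (z - z))) :=
    (ν_cont.tendsto _).comp ((hz.comp tendsto_fst).sub (hz.comp tendsto_snd))
  have hν0 : ν (z - z) = 0 := by
    have := ν_smul 0 0
    simp at this
    rw [sub_self, this]
  -- For normalized vectors the parallelogram law rewrites `h` of the difference through `h` of the
  -- sum, which is at least `μ` times `ν` of the sum, that is, `4` minus `ν` of the difference. So
  -- distances are controlled by the excess over the infimum and by `ν`, which is small along the
  -- subsequence. This replaces weak compactness.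
  have hbound : ∀ p : ℕ × ℕ, c / 2 * ‖x (φ p.1) - x (φ p.2)‖ ^ 2 ≤
      2 * (h (x (φ p.1)) - μ) + 2 * (h (x (φ p.2)) - μ) +
        (μ + K) * ν (J (x (φ p.1)) - J (x (φ p.2))) := by
    intro p
    have h1 := hK (x (φ p.1) - x (φ p.2))
    have h2 := h_par (x (φ p.1)) (x (φ p.2))
    have h3 := hμ (x (φ p.1) + x (φ p.2))
    have h4 := ν_par (J (x (φ p.1))) (J (x (φ p.2)))
    rw [hx1, hx1] at h4
    rw [map_sub] at h1
    rw [map_add, show ν (J (x (φ p.1)) + J (x (φ p.2))) =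
      4 - ν (J (x (φ p.1)) - J (x (φ p.2))) by linarith] at h3
    linarith
  have hlim : Tendsto (fun p : ℕ × ℕ => 2 * (h (x (φ p.1)) - μ) + 2 * (h (x (φ p.2)) - μ) +
        (μ + K) * ν (J (x (φ p.1)) - J (x (φ p.2)))) (atTop ×ˢ atTop) (𝓝 0) := by
    have := ((((hhφ.comp tendsto_fst).sub_const μ).const_mul 2).add
      (((hhφ.comp tendsto_snd).sub_const μ).const_mul 2)).add (hν.const_mul (μ + K))
    rw [sub_self] at hν0
    simpa [hν0] using this
  have hcau : CauchySeq fun n => x (φ n) := by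
    rw [cauchySeq_iff_tendsto_dist_atTop_0, ← prod_atTop_atTop_eq]
    have h1 : Tendsto (fun p : ℕ × ℕ => c / 2 * ‖x (φ p.1) - x (φ p.2)‖ ^ 2) (atTop ×ˢ atTop)
        (𝓝 0) :=
      squeeze_zero (fun p => by positivity) hbound hlim
    have h2 := (h1.const_mul (c / 2)⁻¹).sqrt
    simp only [mul_zero, Real.sqrt_zero] at h2
    refine h2.congr fun p => ?_
    rw [inv_mul_cancel_left₀ (half_pos hc).ne', Real.sqrt_sq (norm_nonneg _), dist_eq_norm]
  obtain ⟨y, hy⟩ := cauchySeq_tendsto_of_complete hcau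
  have hy1 : h y = μ := tendsto_nhds_unique ((h_cont.tendsto y).comp hy) hhφ
  have hy2 : ν (J y) = 1 := by
    refine tendsto_nhds_unique (((ν_cont.comp J.continuous).tendsto y).comp hy) ?_
    simp [Function.comp_def, hx1]
  refine ⟨y, ?_, fun w => ?_⟩
  · rintro rfl
    have := ν_smul 0 0
    simp at this
    simp [this] at hy2
  · rw [hy1, hy2, mul_one]
    exact hμ w

end Minimizer

/-! ### Compactness of the map from derivatives to continuous functions -/

section Primitive

variable {a b : ℝ}

/-- As an inner product with an indicator, the integral is visibly linear in the class `F` and open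
to the Cauchy–Schwarz inequality. -/
theorem integral_Icc_eq_inner (F : Lp ℝ 2 (volume.restrict (Icc a b))) {x y : ℝ}
    (hx : x ∈ Icc a b) (hy : y ∈ Icc a b) (hxy : x ≤ y) :
    ∫ t in x..y, F t = inner ℝ (indicatorConstLp 2 (measurableSet_Ioc (a := x) (b := y))
      (measure_ne_top (volume.restrict (Icc a b)) _) (1 : ℝ)) F := by
  rw [L2.inner_indicatorConstLp_one, intervalIntegral.integral_of_le hxy,
    Measure.restrict_restrict measurableSet_Ioc, inter_eq_left.2]
  exact Ioc_subset_Icc_self.trans (Icc_subset_Icc hx.1 hy.2)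

theorem Lp_intervalIntegrable (F : Lp ℝ 2 (volume.restrict (Icc a b))) {x y : ℝ}
    (hx : x ∈ Icc a b) (hy : y ∈ Icc a b) : IntervalIntegrable F volume x y := by
  have hab := hx.1.trans hx.2
  refine ((Lp.memLp F).intervalIntegrable_Icc hab).mono_set ?_
  rw [uIcc_of_le hab]
  exact uIcc_subset_Icc hx hy

/-- Cauchy–Schwarz on the interval between the two points. This one Hölder estimate supplies the
continuity of primitives, the operator bound, and the equicontinuity for Arzelà–Ascoli. -/
theorem abs_primitive_sub_le (F : Lp ℝ 2 (volume.restrict (Icc a b))) {x y : ℝ}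
    (hx : x ∈ Icc a b) (hy : y ∈ Icc a b) :
    |(∫ t in a..x, F t) - ∫ t in a..y, F t| ≤ ‖F‖ * √|x - y| := by
  wlog hxy : y ≤ x generalizing x y
  · rw [abs_sub_comm, abs_sub_comm x]
    exact this hy hx (le_of_not_ge hxy)
  have ha : a ∈ Icc a b := left_mem_Icc.2 (hx.1.trans hx.2)
  rw [intervalIntegral.integral_interval_sub_left (Lp_intervalIntegrable F ha hx)
    (Lp_intervalIntegrable F ha hy), integral_Icc_eq_inner F hy hx hxy, mul_comm]
  refine (abs_real_inner_le_norm _ _).trans ?_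
  gcongr
  rw [norm_indicatorConstLp two_ne_zero ENNReal.ofNat_ne_top, norm_one, one_mul, Real.sqrt_eq_rpow,
    measureReal_restrict_apply measurableSet_Ioc, inter_eq_left.2
      (Ioc_subset_Icc_self.trans (Icc_subset_Icc hy.1 hx.2)), Real.volume_real_Ioc,
    abs_of_nonneg (sub_nonneg.2 hxy), max_eq_left (sub_nonneg.2 hxy)]
  simp

/-- The primitive that vanishes at `a`, as an operator from `L²(a, b)` to the continuous
functions. -/
noncomputable def primitiveCLM (a b : ℝ) :
    Lp ℝ 2 (volume.restrict (Icc a b)) →L[ℝ] C(Icc a b, ℝ) :=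
  LinearMap.mkContinuous
    { toFun := fun F => ⟨fun x => ∫ t in a..x, F t, by
        refine continuous_iff_continuousAt.2 fun x => ?_
        rw [ContinuousAt, tendsto_iff_dist_tendsto_zero]
        refine squeeze_zero (fun _ => dist_nonneg)
          (fun y => abs_primitive_sub_le F y.2 x.2) ?_
        have : Continuous fun y : Icc a b => ‖F‖ * √|(y : ℝ) - x| := by fun_prop
        simpa using this.tendsto x⟩
      map_add' := fun F G => by
        ext x
        have ha : a ∈ Icc a b := left_mem_Icc.2 (x.2.1.trans x.2.2)
        simp only [ContinuousMap.coe_mk, ContinuousMap.add_apply]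
        rw [integral_Icc_eq_inner _ ha x.2 x.2.1, integral_Icc_eq_inner _ ha x.2 x.2.1,
          integral_Icc_eq_inner _ ha x.2 x.2.1, inner_add_right]
      map_smul' := fun c F => by
        ext x
        have ha : a ∈ Icc a b := left_mem_Icc.2 (x.2.1.trans x.2.2)
        simp only [ContinuousMap.coe_mk, ContinuousMap.smul_apply, RingHom.id_apply]
        rw [integral_Icc_eq_inner _ ha x.2 x.2.1, integral_Icc_eq_inner _ ha x.2 x.2.1,
          inner_smul_right, smul_eq_mul] }
    √(b - a) fun F => by
      refine (ContinuousMap.norm_le _ (by positivity)).2 fun x => ?_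
      have ha : a ∈ Icc a b := left_mem_Icc.2 (x.2.1.trans x.2.2)
      have := abs_primitive_sub_le F x.2 ha
      simp only [intervalIntegral.integral_same, sub_zero] at this
      refine this.trans ?_
      rw [mul_comm]
      gcongr
      rw [abs_of_nonneg (sub_nonneg.2 x.2.1)]
      linarith [x.2.2]

theorem primitiveCLM_apply (F : Lp ℝ 2 (volume.restrict (Icc a b))) (x : Icc a b) :
    primitiveCLM a b F x = ∫ t in a..x, F t := rfl

/-- By Lebesgue differentiation `F` is a.e. the derivative of its primitive. The endpoints are
discarded because the primitive is known to vanish only on `[a, b]`. -/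
theorem primitiveCLM_injective (hab : a ≤ b) {F : Lp ℝ 2 (volume.restrict (Icc a b))}
    (h : primitiveCLM a b F = 0) : F = 0 := by
  rw [Lp.eq_zero_iff_ae_eq_zero, Filter.EventuallyEq, ae_restrict_iff' measurableSet_Icc]
  filter_upwards [((Lp.memLp F).intervalIntegrable_Icc hab).ae_hasDerivAt_integral,
    compl_mem_ae_iff.2 (measure_singleton a), compl_mem_ae_iff.2 (measure_singleton b)]
    with x hx hxa hxb hxI
  have hxab : x ∈ Ioo a b := ⟨lt_of_le_of_ne hxI.1 (Ne.symm hxa), lt_of_le_of_ne hxI.2 hxb⟩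
  have hd := hx (by rw [uIcc_of_le hab]; exact Ioo_subset_Icc_self hxab) a left_mem_uIcc
  refine hd.unique ((hasDerivAt_const x (0 : ℝ)).congr_of_eventuallyEq ?_)
  filter_upwards [Ioo_mem_nhds hxab.1 hxab.2] with y hy
  exact DFunLike.congr_fun h ⟨y, Ioo_subset_Icc_self hy⟩

/-- The image of a bounded set under `primitiveCLM` plus bounded constants is relatively
compact. -/
theorem exists_isCompact_primitiveCLM (a b R : ℝ) :
    ∃ K : Set C(Icc a b, ℝ), IsCompact K ∧
      ∀ (F : Lp ℝ 2 (volume.restrict (Icc a b))) (p : ℝ), ‖F‖ ≤ R → |p| ≤ R →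
        ContinuousMap.const _ p + primitiveCLM a b F ∈ K := by
  set e := (ContinuousMap.isometryEquivBoundedOfCompact (Icc a b) ℝ)
  -- Uniformly bounded functions with a common modulus of continuity of exponent one half; an
  -- additive constant does not affect the modulus.
  set A : Set (BoundedContinuousFunction (Icc a b) ℝ) :=
    {z | (∀ x, |z x| ≤ R + R * √(b - a)) ∧ ∀ x y : Icc a b, |z x - z y| ≤ R * √|(x : ℝ) - y|}
  have hA : IsCompact (closure A) := by
    refine BoundedContinuousFunction.arzela_ascoli (Metric.closedBall 0 (R + R * √(b - a)))
      (isCompact_closedBall _ _) A (fun f x hf => by simpa using hf.1 x) ?_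
    intro x
    refine Metric.equicontinuousAt_of_continuity_modulus
      (fun y : Icc a b => R * √|(x : ℝ) - y|) ?_ _ ?_
    · have : Continuous fun y : Icc a b => R * √|(x : ℝ) - y| := by fun_prop
      simpa using this.tendsto x
    · exact .of_forall fun y f => f.2.2 x y
  refine ⟨e.symm '' closure A, hA.image e.symm.continuous, fun F p hF hp => ?_⟩
  refine ⟨e (ContinuousMap.const _ p + primitiveCLM a b F), subset_closure ⟨fun x => ?_, fun x y => ?_⟩,
    e.symm_apply_apply _⟩
  · change |p + primitiveCLM a b F x| ≤ _
    rw [primitiveCLM_apply]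
    have ha : a ∈ Icc a b := left_mem_Icc.2 (x.2.1.trans x.2.2)
    have := abs_primitive_sub_le F x.2 ha
    simp only [intervalIntegral.integral_same, sub_zero] at this
    refine (abs_add_le _ _).trans (add_le_add hp (this.trans ?_))
    gcongr
    · exact (abs_nonneg p).trans hp
    rw [abs_of_nonneg (sub_nonneg.2 x.2.1)]
    linarith [x.2.2]
  · change |(p + primitiveCLM a b F x) - (p + primitiveCLM a b F y)| ≤ _
    rw [primitiveCLM_apply, primitiveCLM_apply, add_sub_add_left_eq_sub]
    refine (abs_primitive_sub_le F x.2 y.2).trans ?_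
    gcongr

end Primitive

/-- The potential and mass integrals become continuous linear functionals evaluated at squares, from
which the continuity, homogeneity and parallelogram law of the quadratic forms follow. -/
theorem exists_integral_clm {a b : ℝ} (hab : a ≤ b) {q : ℝ → ℝ}
    (hq : IntervalIntegrable q volume a b) :
    ∃ Λ : C(Icc a b, ℝ) →L[ℝ] ℝ, ∀ w, Λ w = ∫ t in a..b, q t * IccExtend hab w t := by
  have hi : ∀ w : C(Icc a b, ℝ), IntervalIntegrable (fun t => q t * IccExtend hab w t) volume a b :=
    fun w => hq.mul_continuousOn (w.continuous.Icc_extend').continuousOn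
  refine ⟨LinearMap.mkContinuous
    { toFun := fun w => ∫ t in a..b, q t * IccExtend hab w t
      map_add' := fun w z => by
        rw [← intervalIntegral.integral_add (hi w) (hi z)]
        refine intervalIntegral.integral_congr fun t _ => ?_
        simp [IccExtend, mul_add]
      map_smul' := fun c w => by
        rw [RingHom.id_apply, smul_eq_mul, ← intervalIntegral.integral_const_mul]
        refine intervalIntegral.integral_congr fun t _ => ?_
        simp [IccExtend, mul_left_comm] }
    (∫ t in a..b, |q t|) fun w => ?_, fun w => rfl⟩
  rw [← intervalIntegral.integral_mul_const]
  refine (intervalIntegral.norm_integral_le_integral_norm hab).trans ?_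
  refine intervalIntegral.integral_mono_on hab (hi w).norm (hq.norm.mul_const _) fun t _ => ?_
  rw [norm_mul]
  exact mul_le_mul_of_nonneg_left (w.norm_coe_le_norm _) (norm_nonneg _)

/-- The finite exceptional set is null, so a piecewise continuous potential is measurable for the
restricted measure. -/
theorem aestronglyMeasurable_of_continuousOn_diff_finset {a b : ℝ} {q : ℝ → ℝ} {S : Finset ℝ}
    (h : ContinuousOn q (Icc a b \ (S : Set ℝ))) :
    AEStronglyMeasurable q (volume.restrict (Icc a b)) := by
  have h1 := h.aestronglyMeasurable (μ := volume)
    (measurableSet_Icc.diff S.finite_toSet.measurableSet)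
  rwa [Measure.restrict_congr_set (sdiff_null_ae_eq_self (S.finite_toSet.measure_zero volume))] at h1

/-! ### The form domain, the energy form and the mass form -/

namespace QuantumGraph

variable {V E : Type*} (G : QuantumGraph V E)

theorem pot_memLp_top (e : E) :
    MemLp (G.pot e) ⊤ (volume.restrict (Icc (G.lo e) (G.hi e))) := by
  obtain ⟨M, hM⟩ := G.pot_bounded e
  obtain ⟨S, hS⟩ := G.pot_piecewise e
  exact memLp_top_of_bound (aestronglyMeasurable_of_continuousOn_diff_finset hS) M
    ((ae_restrict_iff' measurableSet_Icc).2 (.of_forall hM))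

theorem pot_intervalIntegrable (e : E) :
    IntervalIntegrable (G.pot e) volume (G.lo e) (G.hi e) := by
  rw [intervalIntegrable_iff_integrableOn_Icc_of_le (G.lo_lt_hi e).le]
  exact (G.pot_memLp_top e).integrable le_top

/-- The form domain of the Hamiltonian: functions of class `H¹` on the edges, with their
derivatives and vertex values, that are continuous at the vertices and vanish at the Dirichlet
vertices. -/
def formDomain : Submodule ℝ ((E → ℝ → ℝ) × (E → ℝ → ℝ) × (V → ℝ)) where
  carrier := {x | (∀ e, IsH1 (G.lo e) (G.hi e) (x.1 e) (x.2.1 e)) ∧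
    (∀ e, x.1 e (G.lo e) = x.2.2 (G.src e) ∧ x.1 e (G.hi e) = x.2.2 (G.tgt e)) ∧
    ∀ v, G.coupling v = ⊤ → x.2.2 v = 0}
  add_mem' := by
    rintro x y ⟨hx, hx', hx''⟩ ⟨hy, hy', hy''⟩
    refine ⟨fun e => (hx e).add (hy e), fun e => ?_, fun v hv => ?_⟩
    · simp [hx' e, hy' e]
    · simp [hx'' v hv, hy'' v hv]
  zero_mem' := by
    refine ⟨fun e => ⟨MemLp.zero, fun t _ => by simp⟩, fun e => by simp, fun v _ => by simp⟩
  smul_mem' := by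
    rintro c x ⟨hx, hx', hx''⟩
    refine ⟨fun e => (hx e).const_mul c, fun e => ?_, fun v hv => ?_⟩
    · simp [hx' e]
    · simp [hx'' v hv]

/-- The coefficient of the vertex condition, with the value zero at the Dirichlet vertices. -/
noncomputable def strength (v : V) : ℝ := (G.coupling v).untopD 0

variable [Fintype E]

open Classical in
/-- The vertices that are ends of edges. -/
noncomputable def ends : Finset V := Finset.univ.image G.src ∪ Finset.univ.image G.tgt

theorem src_mem_ends (e : E) : G.src e ∈ G.ends := by
  classical
  simp [ends]

theorem tgt_mem_ends (e : E) : G.tgt e ∈ G.ends := by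
  classical
  simp [ends]

theorem mem_ends {v : V} : v ∈ G.ends ↔ ∃ e, G.src e = v ∨ G.tgt e = v := by
  classical
  simp [ends, exists_or]

/-- The bilinear form of the Hamiltonian. -/
noncomputable def energyForm (x y : (E → ℝ → ℝ) × (E → ℝ → ℝ) × (V → ℝ)) : ℝ :=
  ∑ e, (∫ t in (G.lo e)..(G.hi e),
    (x.2.1 e t * y.2.1 e t + G.pot e t * (x.1 e t * y.1 e t))) +
  ∑ v ∈ G.ends, G.strength v * (x.2.2 v * y.2.2 v)

/-- The scalar product of `L²`. -/
noncomputable def massForm (x y : (E → ℝ → ℝ) × (E → ℝ → ℝ) × (V → ℝ)) : ℝ :=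
  ∑ e, ∫ t in (G.lo e)..(G.hi e), x.1 e t * y.1 e t

omit [Fintype E] in
variable {G} in
theorem intervalIntegrable_mul_mul {x y : (E → ℝ → ℝ) × (E → ℝ → ℝ) × (V → ℝ)}
    (hx : x ∈ G.formDomain) (hy : y ∈ G.formDomain) {e : E} {q : ℝ → ℝ}
    (hq : IntervalIntegrable q volume (G.lo e) (G.hi e)) :
    IntervalIntegrable (fun t => q t * (x.1 e t * y.1 e t)) volume (G.lo e) (G.hi e) :=
  hq.mul_continuousOn (by
    rw [uIcc_of_le (G.lo_lt_hi e).le]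
    exact (hx.1 e).continuousOn.mul (hy.1 e).continuousOn)

omit [Fintype E] in
variable {G} in
theorem intervalIntegrable_mul {x y : (E → ℝ → ℝ) × (E → ℝ → ℝ) × (V → ℝ)}
    (hx : x ∈ G.formDomain) (hy : y ∈ G.formDomain) (e : E) :
    IntervalIntegrable (fun t => x.1 e t * y.1 e t) volume (G.lo e) (G.hi e) :=
  ContinuousOn.intervalIntegrable (by
    rw [uIcc_of_le (G.lo_lt_hi e).le]
    exact (hx.1 e).continuousOn.mul (hy.1 e).continuousOn)

omit [Fintype E] in
variable {G} in
theorem intervalIntegrable_deriv_mul_deriv {x y : (E → ℝ → ℝ) × (E → ℝ → ℝ) × (V → ℝ)}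
    (hx : x ∈ G.formDomain) (hy : y ∈ G.formDomain) (e : E) :
    IntervalIntegrable (fun t => x.2.1 e t * y.2.1 e t) volume (G.lo e) (G.hi e) :=
  (hx.1 e).memLp.intervalIntegrable_mul_Icc (G.lo_lt_hi e).le (hy.1 e).memLp

variable {G} in
theorem massForm_pos {x : (E → ℝ → ℝ) × (E → ℝ → ℝ) × (V → ℝ)} (hx : x ∈ G.formDomain)
    (hne : ∃ e, ∃ t ∈ Icc (G.lo e) (G.hi e), x.1 e t ≠ 0) : 0 < G.massForm x x := by
  obtain ⟨e, t, ht, hxt⟩ := hne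
  refine Finset.sum_pos' (fun e _ => intervalIntegral.integral_nonneg (G.lo_lt_hi e).le
    fun _ _ => mul_self_nonneg _) ⟨e, Finset.mem_univ _, ?_⟩
  exact intervalIntegral.integral_pos (G.lo_lt_hi e)
    ((hx.1 e).continuousOn.mul (hx.1 e).continuousOn) (fun _ _ => mul_self_nonneg _)
    ⟨t, ht, mul_self_pos.2 hxt⟩

theorem massForm_nonneg (x : (E → ℝ → ℝ) × (E → ℝ → ℝ) × (V → ℝ)) : 0 ≤ G.massForm x x :=
  Finset.sum_nonneg fun e _ => intervalIntegral.integral_nonneg (G.lo_lt_hi e).le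
    fun _ _ => mul_self_nonneg _

theorem exists_massForm_pos [Nonempty E] : ∃ x ∈ G.formDomain, 0 < G.massForm x x := by
  -- The product of the distances to the two ends vanishes at all vertices, so it meets every vertex
  -- constraint.
  have hmem : ((fun e t => (t - G.lo e) * (G.hi e - t), fun e t => G.hi e + G.lo e - 2 * t,
      fun _ => 0) : (E → ℝ → ℝ) × (E → ℝ → ℝ) × (V → ℝ)) ∈ G.formDomain := by
    refine ⟨fun e => IsH1.of_hasDerivAt (fun t => ?_) (by fun_prop), fun e => by simp, fun _ _ => rfl⟩
    have h := ((hasDerivAt_id t).sub_const (G.lo e)).mul ((hasDerivAt_id t).const_sub (G.hi e))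
    have h2 : 1 * (G.hi e - id t) + (id t - G.lo e) * -1 = G.hi e + G.lo e - 2 * t := by
      simp only [id_eq]
      ring
    rw [h2] at h
    exact h
  refine ⟨_, hmem, massForm_pos hmem ?_⟩
  obtain ⟨e⟩ := ‹Nonempty E›
  have := G.lo_lt_hi e
  refine ⟨e, (G.lo e + G.hi e) / 2, ⟨by linarith, by linarith⟩, ?_⟩
  have h1 : 0 < (G.lo e + G.hi e) / 2 - G.lo e := by linarith
  have h2 : 0 < G.hi e - (G.lo e + G.hi e) / 2 := by linarith
  exact (mul_pos h1 h2).ne'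

/-! ### Existence of a minimizer -/

section Existence

/-- The continuous functions on the edges given by a derivative on each edge and the values at the
vertices. -/
noncomputable def edgeFunctions :
    ((∀ e, Lp ℝ 2 (volume.restrict (Icc (G.lo e) (G.hi e)))) × (V → ℝ)) →L[ℝ]
      (∀ e, C(Icc (G.lo e) (G.hi e), ℝ)) :=
  ContinuousLinearMap.pi fun e =>
    (ContinuousLinearMap.toSpanSingleton ℝ (1 : C(Icc (G.lo e) (G.hi e), ℝ))).comp
      ((ContinuousLinearMap.proj (G.src e)).comp (ContinuousLinearMap.snd ℝ _ _)) +
    (primitiveCLM (G.lo e) (G.hi e)).comp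
      ((ContinuousLinearMap.proj e).comp (ContinuousLinearMap.fst ℝ _ _))

omit [Fintype E] in
theorem edgeFunctions_apply
    (p : (∀ e, Lp ℝ 2 (volume.restrict (Icc (G.lo e) (G.hi e)))) × (V → ℝ)) (e : E)
    (t : Icc (G.lo e) (G.hi e)) :
    G.edgeFunctions p e t = p.2 (G.src e) + ∫ s in (G.lo e)..t, p.1 e s := by
  simp [edgeFunctions, primitiveCLM_apply]

/-- The form domain as a closed subspace of a Banach space. -/
def formSpace : Submodule ℝ
    ((∀ e, Lp ℝ 2 (volume.restrict (Icc (G.lo e) (G.hi e)))) × (V → ℝ)) where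
  -- The value at the source and the derivative determine the function on an edge, so continuity at
  -- the target remains as a constraint. Values at isolated vertices are set to zero; otherwise they
  -- would be invisible to the edge functions and `edgeFunctions` would not be injective here.
  carrier := {p | (∀ e, G.edgeFunctions p e ⟨G.hi e, right_mem_Icc.2 (G.lo_lt_hi e).le⟩ =
      p.2 (G.tgt e)) ∧ ∀ v, (G.coupling v = ⊤ ∨ v ∉ G.ends) → p.2 v = 0}
  add_mem' := by
    rintro p q ⟨hp, hp'⟩ ⟨hq, hq'⟩
    refine ⟨fun e => ?_, fun v hv => ?_⟩
    · simp [hp e, hq e]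
    · simp [hp' v hv, hq' v hv]
  zero_mem' := by simp
  smul_mem' := by
    rintro c p ⟨hp, hp'⟩
    refine ⟨fun e => ?_, fun v hv => ?_⟩
    · simp [hp e]
    · simp [hp' v hv]

theorem isClosed_formSpace : IsClosed (G.formSpace : Set
    ((∀ e, Lp ℝ 2 (volume.restrict (Icc (G.lo e) (G.hi e)))) × (V → ℝ))) := by
  have h1 : ∀ e, Continuous fun p => G.edgeFunctions p e
      ⟨G.hi e, right_mem_Icc.2 (G.lo_lt_hi e).le⟩ := fun e =>
    (continuous_eval_const _).comp ((continuous_apply e).comp G.edgeFunctions.continuous)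
  have h2 : ∀ v, Continuous fun p :
      (∀ e, Lp ℝ 2 (volume.restrict (Icc (G.lo e) (G.hi e)))) × (V → ℝ) => p.2 v :=
    fun v => (continuous_apply v).comp continuous_snd
  refine IsClosed.inter (s₁ := {p | ∀ e, G.edgeFunctions p e
      ⟨G.hi e, right_mem_Icc.2 (G.lo_lt_hi e).le⟩ = p.2 (G.tgt e)})
    (s₂ := {p | ∀ v, (G.coupling v = ⊤ ∨ v ∉ G.ends) → p.2 v = 0}) ?_ ?_
  · simp only [ofPred_forall]
    exact isClosed_iInter fun e => isClosed_eq (h1 e) (h2 _)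
  · simp only [ofPred_forall]
    exact isClosed_iInter fun v => isClosed_iInter fun _ => isClosed_eq (h2 v) continuous_const

/-- A vertex value is either zero or the value of an edge function at an end. Hence the vertex
component of the norm, and the vertex terms of the energy, are dominated by the sup norm, as the
Gårding inequality needs. -/
theorem abs_vertex_le {p : (∀ e, Lp ℝ 2 (volume.restrict (Icc (G.lo e) (G.hi e)))) × (V → ℝ)}
    (hp : p ∈ G.formSpace) (v : V) : |p.2 v| ≤ ‖G.edgeFunctions p‖ := by
  by_cases hv : v ∈ G.ends
  · obtain ⟨e, he⟩ := G.mem_ends.1 hv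
    have key : ∀ t, |G.edgeFunctions p e t| ≤ ‖G.edgeFunctions p‖ := fun t =>
      ((G.edgeFunctions p e).norm_coe_le_norm t).trans (norm_le_pi_norm _ e)
    rcases he with rfl | rfl
    · have := key ⟨G.lo e, left_mem_Icc.2 (G.lo_lt_hi e).le⟩
      rw [edgeFunctions_apply] at this
      simpa using this
    · rw [← hp.1 e]
      exact key _
  · rw [hp.2 v (.inr hv)]
    simp

/-- The Rayleigh quotient of the Hamiltonian attains its minimum on the form domain. -/
theorem exists_minimizer [Finite V] [Nonempty E] :
    ∃ x ∈ G.formDomain, 0 < G.massForm x x ∧ ∀ y ∈ G.formDomain,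
      G.energyForm x x * G.massForm y y ≤ G.energyForm y y * G.massForm x x := by
  have := Fintype.ofFinite V
  choose Λ hΛ using fun e => exists_integral_clm (G.lo_lt_hi e).le (G.pot_intervalIntegrable e)
  choose Λ₁ hΛ₁ using fun e => exists_integral_clm (G.lo_lt_hi e).le
    (intervalIntegrable_const (μ := volume) (a := G.lo e) (b := G.hi e) (c := (1 : ℝ)))
  set ν : (∀ e, C(Icc (G.lo e) (G.hi e), ℝ)) → ℝ := fun z => ∑ e, Λ₁ e (z e * z e) with hν
  set h : G.formSpace → ℝ := fun p => ∑ e, (‖p.1.1 e‖ ^ 2 +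
    Λ e (G.edgeFunctions p.1 e * G.edgeFunctions p.1 e)) +
      ∑ v ∈ G.ends, G.strength v * (p.1.2 v * p.1.2 v) with hh
  -- Dictionary between functions and points of the Banach space: the forms agree once derivatives
  -- agree a.e. and vertex values agree at the ends of edges.
  have transfer : ∀ (p : G.formSpace) (x : (E → ℝ → ℝ) × (E → ℝ → ℝ) × (V → ℝ)),
      x ∈ G.formDomain → (∀ e, x.2.1 e =ᵐ[volume.restrict (Icc (G.lo e) (G.hi e))] p.1.1 e) →
      (∀ v ∈ G.ends, x.2.2 v = p.1.2 v) →
      G.energyForm x x = h p ∧ G.massForm x x = ν (G.edgeFunctions p.1) := by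
    intro p x hx hx' hφ
    have hval : ∀ e, ∀ t (ht : t ∈ Icc (G.lo e) (G.hi e)),
        x.1 e t = G.edgeFunctions p.1 e ⟨t, ht⟩ := by
      intro e t ht
      rw [edgeFunctions_apply, (hx.1 e).integral_deriv t ht, (hx.2.1 e).1,
        hφ _ (G.src_mem_ends e)]
      congr 1
      rw [intervalIntegral.integral_of_le ht.1, intervalIntegral.integral_of_le ht.1]
      refine integral_congr_ae (ae_mono (Measure.restrict_mono ?_ le_rfl) (hx' e))
      exact Ioc_subset_Icc_self.trans (Icc_subset_Icc_right ht.2)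
    have hext : ∀ e, ∀ t ∈ uIcc (G.lo e) (G.hi e), x.1 e t * x.1 e t =
        IccExtend (G.lo_lt_hi e).le (G.edgeFunctions p.1 e * G.edgeFunctions p.1 e) t := by
      intro e t ht
      rw [uIcc_of_le (G.lo_lt_hi e).le] at ht
      rw [IccExtend_of_mem _ _ ht, hval e t ht]
      rfl
    refine ⟨?_, ?_⟩
    · simp only [energyForm, hh]
      congr 1
      · refine Finset.sum_congr rfl fun e _ => ?_
        rw [intervalIntegral.integral_add (intervalIntegrable_deriv_mul_deriv hx hx e)
          (intervalIntegrable_mul_mul hx hx (G.pot_intervalIntegrable e)), hΛ]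
        congr 1
        · rw [← real_inner_self_eq_norm_sq, L2.inner_def,
            intervalIntegral.integral_of_le (G.lo_lt_hi e).le, ← integral_Icc_eq_integral_Ioc]
          refine integral_congr_ae ?_
          filter_upwards [hx' e] with t ht
          simp [ht, sq]
        · refine intervalIntegral.integral_congr fun t ht => ?_
          simp only [hext e t ht]
      · exact Finset.sum_congr rfl fun v hv => by rw [hφ v hv]
    · simp only [massForm, hν]
      refine Finset.sum_congr rfl fun e _ => ?_
      rw [hΛ₁]
      refine intervalIntegral.integral_congr fun t ht => ?_
      simp only [hext e t ht, one_mul]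
  have toSpace : ∀ x ∈ G.formDomain, ∃ p : G.formSpace,
      G.energyForm x x = h p ∧ G.massForm x x = ν (G.edgeFunctions p.1) := by
    classical
    intro x hx
    set p : (∀ e, Lp ℝ 2 (volume.restrict (Icc (G.lo e) (G.hi e)))) × (V → ℝ) :=
      (fun e => (hx.1 e).memLp.toLp, fun v => if v ∈ G.ends then x.2.2 v else 0) with hp
    have hp1 : ∀ e, x.2.1 e =ᵐ[volume.restrict (Icc (G.lo e) (G.hi e))] p.1 e :=
      fun e => ((hx.1 e).memLp.coeFn_toLp).symm
    have hmem : p ∈ G.formSpace := by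
      refine ⟨fun e => ?_, fun v hv => ?_⟩
      · rw [edgeFunctions_apply]
        simp only [hp, G.src_mem_ends, G.tgt_mem_ends, if_true]
        rw [← (hx.2.1 e).2, ← (hx.2.1 e).1, (hx.1 e).integral_deriv _
          (right_mem_Icc.2 (G.lo_lt_hi e).le)]
        congr 1
        rw [intervalIntegral.integral_of_le (G.lo_lt_hi e).le,
          intervalIntegral.integral_of_le (G.lo_lt_hi e).le]
        exact integral_congr_ae (ae_mono (Measure.restrict_mono Ioc_subset_Icc_self le_rfl)
          (hp1 e).symm)
      · rcases hv with hv | hv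
        · simp [hp, hx.2.2 v hv]
        · simp [hp, hv]
    exact ⟨⟨p, hmem⟩, transfer ⟨p, hmem⟩ x hx hp1 fun v hv => by simp [hp, hv]⟩
  have ofSpace : ∀ p : G.formSpace, ∃ x ∈ G.formDomain,
      G.energyForm x x = h p ∧ G.massForm x x = ν (G.edgeFunctions p.1) := by
    intro p
    set x : (E → ℝ → ℝ) × (E → ℝ → ℝ) × (V → ℝ) :=
      (fun e t => p.1.2 (G.src e) + ∫ s in (G.lo e)..t, p.1.1 e s, fun e => p.1.1 e, p.1.2)
      with hxdef
    have hx : x ∈ G.formDomain := by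
      refine ⟨fun e => ⟨Lp.memLp _, fun t _ => by simp [hxdef]⟩, fun e => ⟨by simp [hxdef], ?_⟩,
        fun v hv => p.2.2 v (.inl hv)⟩
      rw [← p.2.1 e, edgeFunctions_apply]
    exact ⟨x, hx, transfer p x hx (fun e => ae_eq_rfl) fun _ _ => rfl⟩
  have hcomplete : CompleteSpace G.formSpace := G.isClosed_formSpace.completeSpace_coe
  have νpos : ∀ z ≠ 0, 0 < ν z := by
    intro z hz
    obtain ⟨e, he⟩ := Function.ne_iff.1 hz
    obtain ⟨t, ht⟩ := DFunLike.ne_iff.1 he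
    refine Finset.sum_pos' (fun e _ => ?_) ⟨e, Finset.mem_univ _, ?_⟩
    · rw [hΛ₁]
      exact intervalIntegral.integral_nonneg (G.lo_lt_hi e).le fun t _ => by
        simpa [IccExtend] using mul_self_nonneg _
    · rw [hΛ₁]
      refine intervalIntegral.integral_pos (G.lo_lt_hi e) ?_ (fun t _ => by
        simpa [IccExtend] using mul_self_nonneg _) ⟨t, t.2, ?_⟩
      · exact (continuous_const.mul (ContinuousMap.continuous _).Icc_extend').continuousOn
      · rw [IccExtend_of_mem _ _ t.2, one_mul]
        exact mul_self_pos.2 ht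
  have νcont : Continuous ν := continuous_finsetSum _ fun e _ =>
    (Λ₁ e).continuous.comp ((continuous_apply e).mul (continuous_apply e))
  have νsmul : ∀ (t : ℝ) z, ν (t • z) = t ^ 2 * ν z := fun t z => by
    simp only [hν, Finset.mul_sum]
    refine Finset.sum_congr rfl fun e _ => ?_
    rw [Pi.smul_apply, smul_mul_smul_comm, map_smul, smul_eq_mul, sq]
  have quad : ∀ {e} (L : C(Icc (G.lo e) (G.hi e), ℝ) →L[ℝ] ℝ) (z w : C(Icc (G.lo e) (G.hi e), ℝ)),
      L ((z + w) * (z + w)) + L ((z - w) * (z - w)) = 2 * L (z * z) + 2 * L (w * w) := by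
    intro e L z w
    rw [← map_add, show (z + w) * (z + w) + (z - w) * (z - w) =
      (2 : ℝ) • (z * z) + (2 : ℝ) • (w * w) by rw [two_smul, two_smul]; ring, map_add, map_smul,
      map_smul, smul_eq_mul, smul_eq_mul]
  have νpar : ∀ z w, ν (z + w) + ν (z - w) = 2 * ν z + 2 * ν w := fun z w => by
    simp only [hν, Finset.mul_sum, ← Finset.sum_add_distrib]
    exact Finset.sum_congr rfl fun e _ => quad _ _ _
  have hcont : Continuous h := by
    have c1 : Continuous fun p : G.formSpace => G.edgeFunctions p.1 :=
      G.edgeFunctions.continuous.comp continuous_subtype_val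
    have c2 : Continuous fun p : G.formSpace => p.1.1 := continuous_fst.comp continuous_subtype_val
    have c3 : Continuous fun p : G.formSpace => p.1.2 := continuous_snd.comp continuous_subtype_val
    refine (continuous_finsetSum _ fun e _ => ?_).add (continuous_finsetSum _ fun v _ => ?_)
    · exact (((continuous_apply e).comp c2).norm.pow 2).add ((Λ e).continuous.comp
        (((continuous_apply e).comp c1).mul ((continuous_apply e).comp c1)))
    · exact continuous_const.mul (((continuous_apply v).comp c3).mul ((continuous_apply v).comp c3))
  have hsmul : ∀ (t : ℝ) p, h (t • p) = t ^ 2 * h p := fun t p => by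
    simp only [hh, mul_add, Finset.mul_sum]
    congr 1
    · refine Finset.sum_congr rfl fun e _ => ?_
      rw [Submodule.coe_smul, map_smul, Pi.smul_apply, smul_mul_smul_comm, map_smul, smul_eq_mul,
        Prod.smul_fst, Pi.smul_apply, norm_smul, mul_pow, Real.norm_eq_abs, sq_abs, sq t]
    · refine Finset.sum_congr rfl fun v _ => ?_
      simp only [Submodule.coe_smul, Prod.smul_snd, Pi.smul_apply, smul_eq_mul]
      ring
  have hpar : ∀ p q, h (p + q) + h (p - q) = 2 * h p + 2 * h q := fun p q => by
    have e1 : h (p + q) + h (p - q) = ∑ e, ((‖p.1.1 e + q.1.1 e‖ ^ 2 + ‖p.1.1 e - q.1.1 e‖ ^ 2) +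
        (Λ e ((G.edgeFunctions p.1 e + G.edgeFunctions q.1 e) *
          (G.edgeFunctions p.1 e + G.edgeFunctions q.1 e)) +
        Λ e ((G.edgeFunctions p.1 e - G.edgeFunctions q.1 e) *
          (G.edgeFunctions p.1 e - G.edgeFunctions q.1 e)))) +
        ∑ v ∈ G.ends, (G.strength v * ((p.1.2 v + q.1.2 v) * (p.1.2 v + q.1.2 v)) +
          G.strength v * ((p.1.2 v - q.1.2 v) * (p.1.2 v - q.1.2 v))) := by
      simp only [hh, Finset.sum_add_distrib, Submodule.coe_add, Submodule.coe_sub, map_add, map_sub,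
        Pi.add_apply, Pi.sub_apply, Prod.fst_add, Prod.fst_sub, Prod.snd_add, Prod.snd_sub]
      ring
    rw [e1]
    simp only [hh]
    rw [mul_add, mul_add, Finset.mul_sum, Finset.mul_sum, Finset.mul_sum, Finset.mul_sum,
      add_add_add_comm, ← Finset.sum_add_distrib, ← Finset.sum_add_distrib]
    congr 1
    · refine Finset.sum_congr rfl fun e _ => ?_
      rw [quad]
      have := parallelogram_law_with_norm ℝ (p.1.1 e) (q.1.1 e)
      rw [this]
      ring
    · exact Finset.sum_congr rfl fun v _ => by ring
  -- The norms of the potential functionals and the coefficients absorb the lower order terms of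
  -- `h`; the summand `1` pays for the vertex component of `‖p‖`.
  set C : ℝ := 1 + ∑ e, ‖Λ e‖ + ∑ v ∈ G.ends, |G.strength v| with hC
  have garding : ∀ p : G.formSpace, 1 * ‖p‖ ^ 2 ≤ h p + C * ‖G.edgeFunctions p.1‖ ^ 2 := by
    intro p
    set N := ‖G.edgeFunctions p.1‖
    have hN : 0 ≤ N := norm_nonneg _
    have hF : ‖p‖ ^ 2 ≤ ∑ e, ‖p.1.1 e‖ ^ 2 + N ^ 2 := by
      have hnn : 0 ≤ ∑ e, ‖p.1.1 e‖ ^ 2 := Finset.sum_nonneg fun e _ => sq_nonneg _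
      have : ‖p‖ ≤ √(∑ e, ‖p.1.1 e‖ ^ 2 + N ^ 2) := by
        change ‖p.1‖ ≤ _
        rw [Prod.norm_def, max_le_iff, pi_norm_le_iff_of_nonneg (Real.sqrt_nonneg _),
          pi_norm_le_iff_of_nonneg (Real.sqrt_nonneg _)]
        refine ⟨fun e => Real.le_sqrt_of_sq_le ?_, fun v => Real.le_sqrt_of_sq_le ?_⟩
        · have := Finset.single_le_sum (f := fun e => ‖p.1.1 e‖ ^ 2) (fun e _ => sq_nonneg _)
            (Finset.mem_univ e)
          nlinarith
        · have := pow_le_pow_left₀ (abs_nonneg _) (G.abs_vertex_le p.2 v) 2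
          rw [Real.norm_eq_abs]
          linarith
      calc ‖p‖ ^ 2 ≤ √(∑ e, ‖p.1.1 e‖ ^ 2 + N ^ 2) ^ 2 := by gcongr
        _ = _ := Real.sq_sqrt (by positivity)
    have h1 : -(∑ e, ‖Λ e‖ * N ^ 2) ≤
        ∑ e, Λ e (G.edgeFunctions p.1 e * G.edgeFunctions p.1 e) := by
      rw [← Finset.sum_neg_distrib]
      refine Finset.sum_le_sum fun e _ => ?_
      have hb : |Λ e (G.edgeFunctions p.1 e * G.edgeFunctions p.1 e)| ≤ ‖Λ e‖ * N ^ 2 := by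
        refine ((Λ e).le_opNorm _).trans ?_
        gcongr
        refine (norm_mul_le _ _).trans ?_
        rw [sq]
        gcongr <;> exact norm_le_pi_norm _ e
      exact (abs_le.1 hb).1
    have h2 : -(∑ v ∈ G.ends, |G.strength v| * N ^ 2) ≤
        ∑ v ∈ G.ends, G.strength v * (p.1.2 v * p.1.2 v) := by
      rw [← Finset.sum_neg_distrib]
      refine Finset.sum_le_sum fun v _ => ?_
      have hb : |G.strength v * (p.1.2 v * p.1.2 v)| ≤ |G.strength v| * N ^ 2 := by
        rw [abs_mul, abs_mul, sq]
        gcongr <;> exact G.abs_vertex_le p.2 v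
      exact (abs_le.1 hb).1
    simp only [hh, hC, Finset.sum_add_distrib, add_mul, Finset.sum_mul, one_mul]
    linarith
  have compact : ∀ R : ℝ, ∃ K : Set (∀ e, C(Icc (G.lo e) (G.hi e), ℝ)), IsCompact K ∧
      ∀ p : G.formSpace, ‖p‖ ≤ R → G.edgeFunctions p.1 ∈ K := by
    intro R
    choose K hK hKm using fun e => exists_isCompact_primitiveCLM (G.lo e) (G.hi e) R
    refine ⟨univ.pi K, isCompact_univ_pi hK, fun p hp e _ => ?_⟩
    have h1 : ‖p.1.1 e‖ ≤ R := (norm_le_pi_norm p.1.1 e).trans ((norm_fst_le p.1).trans hp)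
    have h2 : ‖p.1.2 (G.src e)‖ ≤ R :=
      (norm_le_pi_norm p.1.2 _).trans ((norm_snd_le p.1).trans hp)
    convert hKm e _ _ h1 h2
    ext t
    rw [edgeFunctions_apply]
    rfl
  have hinj : ∀ p : G.formSpace, G.edgeFunctions p.1 = 0 → p = 0 := by
    intro p h0
    have hφ : p.1.2 = 0 := by
      ext v
      have := G.abs_vertex_le p.2 v
      rw [h0, norm_zero] at this
      exact abs_nonpos_iff.1 this
    refine Subtype.ext (Prod.ext (funext fun e => primitiveCLM_injective (G.lo_lt_hi e).le ?_) hφ)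
    ext t
    have := G.edgeFunctions_apply p.1 e t
    rw [h0, hφ, Pi.zero_apply (G.src e), zero_add] at this
    exact this.symm
  have hnt : Nontrivial G.formSpace := by
    obtain ⟨x, hx, hpos⟩ := G.exists_massForm_pos
    obtain ⟨p, -, hp⟩ := toSpace x hx
    refine ⟨p, 0, ?_⟩
    rintro rfl
    have := νsmul 0 0
    simp at this
    simp [hp, this] at hpos
  obtain ⟨p, hp, hmin⟩ := exists_rayleigh_minimizer (G.edgeFunctions.comp G.formSpace.subtypeL) hinj
    hcont hsmul hpar νcont νsmul νpar νpos one_pos garding compact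
  obtain ⟨x, hx, hx1, hx2⟩ := ofSpace p
  refine ⟨x, hx, ?_, fun y hy => ?_⟩
  · rw [hx2]
    exact νpos _ fun h0 => hp (hinj p h0)
  · obtain ⟨q, hq1, hq2⟩ := toSpace y hy
    rw [hx1, hx2, hq1, hq2]
    exact hmin q

end Existence

end QuantumGraph

/-! ### Weak solutions, regularity, and the variational characterization of the lowest eigenvalue -/

namespace QuantumGraph

variable {V E : Type*} {G : QuantumGraph V E} [Fintype E]

theorem energyForm_comm (x y : (E → ℝ → ℝ) × (E → ℝ → ℝ) × (V → ℝ)) :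
    G.energyForm x y = G.energyForm y x := by
  simp only [energyForm, mul_comm]

theorem massForm_comm (x y : (E → ℝ → ℝ) × (E → ℝ → ℝ) × (V → ℝ)) :
    G.massForm x y = G.massForm y x := by
  simp only [massForm, mul_comm]

section Bilinear

variable {x y z : (E → ℝ → ℝ) × (E → ℝ → ℝ) × (V → ℝ)}

theorem energyForm_add_smul (hx : x ∈ G.formDomain) (hy : y ∈ G.formDomain)
    (hz : z ∈ G.formDomain) (c : ℝ) :
    G.energyForm (x + c • y) z = G.energyForm x z + c * G.energyForm y z := by
  simp only [energyForm]
  rw [mul_add, add_add_add_comm, Finset.mul_sum, Finset.mul_sum, ← Finset.sum_add_distrib,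
    ← Finset.sum_add_distrib]
  congr 1
  · refine Finset.sum_congr rfl fun e _ => ?_
    have h1 := (intervalIntegrable_deriv_mul_deriv hx hz e).add
      (intervalIntegrable_mul_mul hx hz (G.pot_intervalIntegrable e))
    have h2 := (intervalIntegrable_deriv_mul_deriv hy hz e).add
      (intervalIntegrable_mul_mul hy hz (G.pot_intervalIntegrable e))
    rw [← intervalIntegral.integral_const_mul, ← intervalIntegral.integral_add h1 (h2.const_mul c)]
    refine intervalIntegral.integral_congr fun t _ => ?_
    simp
    ring
  · refine Finset.sum_congr rfl fun v _ => ?_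
    simp
    ring

theorem massForm_add_smul (hx : x ∈ G.formDomain) (hy : y ∈ G.formDomain)
    (hz : z ∈ G.formDomain) (c : ℝ) :
    G.massForm (x + c • y) z = G.massForm x z + c * G.massForm y z := by
  simp only [massForm]
  rw [Finset.mul_sum, ← Finset.sum_add_distrib]
  refine Finset.sum_congr rfl fun e _ => ?_
  rw [← intervalIntegral.integral_const_mul, ← intervalIntegral.integral_add
    (intervalIntegrable_mul hx hz e) ((intervalIntegrable_mul hy hz e).const_mul c)]
  refine intervalIntegral.integral_congr fun t _ => ?_
  simp
  ring

/-- The Euler-Lagrange equation of a minimizer of the Rayleigh quotient. -/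
theorem energyForm_eq_of_minimizer {μ : ℝ}
    (hμ : ∀ y ∈ G.formDomain, μ * G.massForm y y ≤ G.energyForm y y)
    (hx : x ∈ G.formDomain) (h : G.energyForm x x = μ * G.massForm x x) (hy : y ∈ G.formDomain) :
    G.energyForm x y = μ * G.massForm x y := by
  -- Minimality along the line `x + c • y`: a nonnegative quadratic in `c` with zero constant term
  -- has zero linear coefficient, by its discriminant.
  have key : ∀ c : ℝ, 0 ≤ (G.energyForm y y - μ * G.massForm y y) * (c * c) +
      2 * (G.energyForm x y - μ * G.massForm x y) * c + 0 := fun c => by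
    have hxy := G.formDomain.add_mem hx (G.formDomain.smul_mem c hy)
    have h1 := hμ _ hxy
    rw [energyForm_add_smul hx hy hxy, massForm_add_smul hx hy hxy,
      energyForm_comm x (x + c • y), energyForm_comm y (x + c • y),
      massForm_comm x (x + c • y), massForm_comm y (x + c • y),
      energyForm_add_smul hx hy hx, energyForm_add_smul hx hy hy, massForm_add_smul hx hy hx,
      massForm_add_smul hx hy hy, h, energyForm_comm y x, massForm_comm y x] at h1
    linarith
  have := discrim_le_zero key
  rw [discrim] at this
  nlinarith [sq_nonneg (G.energyForm x y - μ * G.massForm x y)]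

end Bilinear

/-- Green's formula. -/
theorem sum_integral_eq_neg_sum_outgoingSum {f' f'' : E → ℝ → ℝ}
    (hf : ∀ e, IsH1 (G.lo e) (G.hi e) (f' e) (f'' e))
    {y : (E → ℝ → ℝ) × (E → ℝ → ℝ) × (V → ℝ)} (hy : y ∈ G.formDomain) :
    ∑ e, (∫ t in (G.lo e)..(G.hi e), (f'' e t * y.1 e t + f' e t * y.2.1 e t)) =
      -∑ v ∈ G.ends, G.outgoingSum f' v * y.2.2 v := by
  classical
  have h1 : ∀ e, (∫ t in (G.lo e)..(G.hi e), (f'' e t * y.1 e t + f' e t * y.2.1 e t)) =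
      f' e (G.hi e) * y.2.2 (G.tgt e) - f' e (G.lo e) * y.2.2 (G.src e) := fun e => by
    rw [((hf e).isAC (G.lo_lt_hi e).le).integral_mul ((hy.1 e).isAC (G.lo_lt_hi e).le)
      (G.lo_lt_hi e).le, (hy.2.1 e).1, (hy.2.1 e).2]
  simp_rw [h1, outgoingSum, Finset.sum_mul]
  rw [Finset.sum_comm, ← Finset.sum_neg_distrib]
  refine Finset.sum_congr rfl fun e _ => ?_
  simp_rw [add_mul, ite_mul, zero_mul]
  rw [Finset.sum_add_distrib, Finset.sum_ite_eq, Finset.sum_ite_eq, if_pos (G.src_mem_ends e),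
    if_pos (G.tgt_mem_ends e)]
  ring

/-- A function of the form domain that satisfies the eigenvalue equation in the weak sense is of
class `H²` on the edges, and satisfies the equation and the vertex conditions. -/
theorem exists_isH2_of_weak {μ : ℝ} {x : (E → ℝ → ℝ) × (E → ℝ → ℝ) × (V → ℝ)}
    (hx : x ∈ G.formDomain)
    (h : ∀ y ∈ G.formDomain, G.energyForm x y = μ * G.massForm x y) :
    ∃ f' : E → ℝ → ℝ,
      (∀ e, IsH2 (G.lo e) (G.hi e) (x.1 e) (f' e) fun t => (G.pot e t - μ) * x.1 e t) ∧
      ∀ v ∈ G.ends, G.coupling v ≠ ⊤ → G.outgoingSum f' v = G.strength v * x.2.2 v := by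
  classical
  set w : E → ℝ → ℝ := fun e t => (G.pot e t - μ) * x.1 e t with hw
  have hle : ∀ e, G.lo e ≤ G.hi e := fun e => (G.lo_lt_hi e).le
  have hwm : ∀ e, MemLp (w e) 2 (volume.restrict (Icc (G.lo e) (G.hi e))) := fun e =>
    MemLp.mul (p := ⊤) (q := 2) (hx.1 e).continuousOn.memLp_two_Icc
      ((G.pot_memLp_top e).sub (memLp_const μ))
  have hwi : ∀ e, IntervalIntegrable (w e) volume (G.lo e) (G.hi e) := fun e =>
    (hwm e).intervalIntegrable_Icc (hle e)
  have weak : ∀ y ∈ G.formDomain, ∑ e, (∫ t in (G.lo e)..(G.hi e),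
      (x.2.1 e t * y.2.1 e t + w e t * y.1 e t)) +
      ∑ v ∈ G.ends, G.strength v * (x.2.2 v * y.2.2 v) = 0 := by
    intro y hy
    have h1 := h y hy
    simp only [energyForm, massForm] at h1
    rw [Finset.mul_sum, ← sub_eq_zero, add_sub_right_comm, ← Finset.sum_sub_distrib] at h1
    rw [← h1]
    congr 1
    refine Finset.sum_congr rfl fun e _ => ?_
    rw [← intervalIntegral.integral_const_mul, ← intervalIntegral.integral_sub
      ((intervalIntegrable_deriv_mul_deriv hx hy e).add
        (intervalIntegrable_mul_mul hx hy (G.pot_intervalIntegrable e)))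
      ((intervalIntegrable_mul hx hy e).const_mul μ)]
    refine intervalIntegral.integral_congr fun t _ => ?_
    simp only [hw]
    ring
  have edge : ∀ e, ∃ c : ℝ, x.2.1 e =ᵐ[volume.restrict (Icc (G.lo e) (G.hi e))]
      fun t => c + ∫ s in (G.lo e)..t, w e s := by
    intro e
    refine (hx.1 e).exists_ae_eq_primitive (G.lo_lt_hi e) (hwi e) fun g g' hg ha hb => ?_
    -- Test functions supported on a single edge isolate the equation on that edge.
    have hy : ((Pi.single e g, Pi.single e g', 0) : (E → ℝ → ℝ) × (E → ℝ → ℝ) × (V → ℝ)) ∈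
        G.formDomain := by
      refine ⟨fun e' => ?_, fun e' => ?_, fun _ _ => rfl⟩
      · rcases eq_or_ne e' e with rfl | hne
        · simpa using hg
        · simpa [hne] using (G.formDomain.zero_mem).1 e'
      · rcases eq_or_ne e' e with rfl | hne
        · simp [ha, hb]
        · simp [hne]
    have h1 := weak _ hy
    rw [Finset.sum_eq_single e (fun e' _ hne => by simp [hne]) (by simp)] at h1
    simpa using h1
  choose c hc using edge
  set f' : E → ℝ → ℝ := fun e t => c e + ∫ s in (G.lo e)..t, w e s with hf'
  have hH1 : ∀ e, IsH1 (G.lo e) (G.hi e) (f' e) (w e) := fun e =>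
    ⟨hwm e, fun t _ => by simp [hf']⟩
  -- The given derivative `x.2.1` equals the continuous representative `f'` only a.e., so it can be
  -- exchanged under integrals but not at the ends of edges.
  have hcongr : ∀ e, ∀ t ∈ Icc (G.lo e) (G.hi e), ∀ k : ℝ → ℝ,
      ∫ s in (G.lo e)..t, x.2.1 e s * k s = ∫ s in (G.lo e)..t, f' e s * k s := by
    intro e t ht k
    rw [intervalIntegral.integral_of_le ht.1, intervalIntegral.integral_of_le ht.1]
    refine integral_congr_ae ?_
    filter_upwards [ae_mono (Measure.restrict_mono
      (Ioc_subset_Icc_self.trans (Icc_subset_Icc_right ht.2)) le_rfl) (hc e)] with s hs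
    rw [hs]
  refine ⟨f', fun e => ⟨hwm e, fun t ht => ?_, (hH1 e).integral_deriv⟩, fun v hv hvD => ?_⟩
  · rw [(hx.1 e).integral_deriv t ht]
    simpa using hcongr e t ht 1
  -- The edgewise linear function with value one at `v` and zero at every other vertex; it handles
  -- loops as well. By Green's formula, testing with it leaves only the vertex condition at `v`.
  · set d : V → ℝ := Pi.single v 1 with hd
    set y : (E → ℝ → ℝ) × (E → ℝ → ℝ) × (V → ℝ) :=
      (fun e t => d (G.src e) + (d (G.tgt e) - d (G.src e)) / (G.hi e - G.lo e) * (t - G.lo e),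
        fun e _ => (d (G.tgt e) - d (G.src e)) / (G.hi e - G.lo e), d) with hydef
    have hy : y ∈ G.formDomain := by
      refine ⟨fun e => IsH1.linear _ _ _, fun e => ⟨by simp [hydef], ?_⟩, fun u hu => ?_⟩
      · simp only [hydef]
        rw [div_mul_cancel₀ _ (sub_ne_zero.2 (G.lo_lt_hi e).ne')]
        ring
      · have : u ≠ v := by rintro rfl; exact hvD hu
        simp [hydef, hd, this]
    have h1 := weak y hy
    have h2 := sum_integral_eq_neg_sum_outgoingSum hH1 hy
    have h3 : ∀ k : V → ℝ, ∑ u ∈ G.ends, k u * y.2.2 u = k v := fun k => by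
      rw [Finset.sum_eq_single v (fun u _ hne => by simp [hydef, hd, hne]) (fun h => absurd hv h)]
      simp [hydef, hd]
    have h4 : ∑ e, (∫ t in (G.lo e)..(G.hi e), (x.2.1 e t * y.2.1 e t + w e t * y.1 e t)) =
        ∑ e, (∫ t in (G.lo e)..(G.hi e), (w e t * y.1 e t + f' e t * y.2.1 e t)) := by
      refine Finset.sum_congr rfl fun e _ => ?_
      have i1 : IntervalIntegrable (fun t => w e t * y.1 e t) volume (G.lo e) (G.hi e) :=
        (hwm e).intervalIntegrable_mul_Icc (hle e) (hy.1 e).continuousOn.memLp_two_Icc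
      rw [intervalIntegral.integral_add (intervalIntegrable_deriv_mul_deriv hx hy e) i1,
        intervalIntegral.integral_add i1 ((hH1 e).continuousOn.memLp_two_Icc.intervalIntegrable_mul_Icc
          (hle e) (hy.1 e).memLp), hcongr e _ (right_mem_Icc.2 (hle e)), add_comm]
    rw [h4, h2] at h1
    simp_rw [← mul_assoc] at h1
    rw [h3, h3 (fun u => G.strength u * x.2.2 u)] at h1
    linarith

theorem outgoingSum_eq_zero_of_notMem_ends {v : V} (hv : v ∉ G.ends) (f' : E → ℝ → ℝ) :
    G.outgoingSum f' v = 0 := by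
  classical
  rw [mem_ends] at hv
  push Not at hv
  exact Finset.sum_eq_zero fun e _ => by simp [hv e]

/-- A nonzero minimizer of the Rayleigh quotient is an eigenfunction. -/
theorem isEigenvalue_of_weak {μ : ℝ} {x : (E → ℝ → ℝ) × (E → ℝ → ℝ) × (V → ℝ)}
    (hx : x ∈ G.formDomain) (hpos : 0 < G.massForm x x)
    (h : ∀ y ∈ G.formDomain, G.energyForm x y = μ * G.massForm x y) : G.IsEigenvalue μ := by
  classical
  obtain ⟨f', hf', hv⟩ := exists_isH2_of_weak hx h
  -- The values at isolated vertices are reset to zero: the outgoing sum is empty there, so the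
  -- vertex condition demands that the coupling times the value vanish.
  refine ⟨x.1, f', _, ⟨hf', fun v => if v ∈ G.ends then x.2.2 v else 0, fun e => ?_, fun v hvD => ?_,
    fun v α hα => ?_⟩, ?_, fun e => ?_⟩
  · simp [G.src_mem_ends, G.tgt_mem_ends, hx.2.1 e]
  · simp [hx.2.2 v hvD]
  · by_cases hve : v ∈ G.ends
    · rw [hv v hve (by simp [hα]), strength, hα]
      simp [hve]
    · rw [outgoingSum_eq_zero_of_notMem_ends hve]
      simp [hve]
  · by_contra hcon
    push Not at hcon
    refine hpos.ne' (Finset.sum_eq_zero fun e _ => ?_)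
    rw [intervalIntegral.integral_congr (g := fun _ => 0), intervalIntegral.integral_zero]
    intro t ht
    rw [uIcc_of_le (G.lo_lt_hi e).le] at ht
    simp [hcon e t ht]
  · exact .of_forall fun t => by ring

/-- The Rayleigh quotient of an eigenfunction is the eigenvalue. -/
theorem IsEigenvalue.exists_mem_formDomain {μ : ℝ} (h : G.IsEigenvalue μ) :
    ∃ x ∈ G.formDomain, 0 < G.massForm x x ∧ G.energyForm x x = μ * G.massForm x x := by
  obtain ⟨f, f', f'', ⟨hf, φ, hφ, hφD, hφα⟩, hne, heq⟩ := h
  have hx : ((f, f', φ) : (E → ℝ → ℝ) × (E → ℝ → ℝ) × (V → ℝ)) ∈ G.formDomain :=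
    ⟨fun e => (hf e).isH1, hφ, hφD⟩
  refine ⟨_, hx, massForm_pos hx hne, ?_⟩
  have h1 := sum_integral_eq_neg_sum_outgoingSum (fun e => (hf e).isH1_deriv) hx
  have h2 : ∑ v ∈ G.ends, G.outgoingSum f' v * φ v =
      ∑ v ∈ G.ends, G.strength v * (φ v * φ v) := by
    refine Finset.sum_congr rfl fun v _ => ?_
    by_cases hv : G.coupling v = ⊤
    · simp [hφD v hv]
    · obtain ⟨α, hα⟩ := WithTop.ne_top_iff_exists.1 hv
      rw [hφα v α hα.symm, strength, ← hα, mul_assoc]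
      rfl
  simp only [energyForm, massForm]
  rw [← h2, ← neg_eq_iff_eq_neg.2 h1, ← sub_eq_add_neg, ← Finset.sum_sub_distrib, Finset.mul_sum]
  refine Finset.sum_congr rfl fun e _ => ?_
  have i1 : IntervalIntegrable (fun t => f'' e t * f e t + f' e t * f' e t) volume
      (G.lo e) (G.hi e) :=
    ((hf e).memLp.intervalIntegrable_mul_Icc (G.lo_lt_hi e).le
      (hf e).isH1.continuousOn.memLp_two_Icc).add (intervalIntegrable_deriv_mul_deriv hx hx e)
  rw [← intervalIntegral.integral_sub ((intervalIntegrable_deriv_mul_deriv hx hx e).add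
    (intervalIntegrable_mul_mul hx hx (G.pot_intervalIntegrable e))) i1,
    ← intervalIntegral.integral_const_mul, intervalIntegral.integral_of_le (G.lo_lt_hi e).le,
    intervalIntegral.integral_of_le (G.lo_lt_hi e).le]
  refine integral_congr_ae ?_
  filter_upwards [ae_mono (Measure.restrict_mono Ioc_subset_Icc_self le_rfl) (heq e)] with t ht
  have : G.pot e t * f e t = f'' e t + μ * f e t := by linarith
  rw [← mul_assoc, this]
  ring

/-- The variational characterization of the lowest eigenvalue. -/
theorem isLeast_groundEnergy_and_le [Finite V] [Nonempty E] :
    IsLeast G.eigenvalues G.groundEnergy ∧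
      (∀ y ∈ G.formDomain, G.groundEnergy * G.massForm y y ≤ G.energyForm y y) ∧
      ∃ x ∈ G.formDomain, 0 < G.massForm x x ∧
        G.energyForm x x = G.groundEnergy * G.massForm x x := by
  obtain ⟨x, hx, hpos, hmin⟩ := G.exists_minimizer
  set μ := G.energyForm x x / G.massForm x x with hμdef
  have hxμ : G.energyForm x x = μ * G.massForm x x := (div_mul_cancel₀ _ hpos.ne').symm
  have hμ : ∀ y ∈ G.formDomain, μ * G.massForm y y ≤ G.energyForm y y := fun y hy => by
    have := hmin y hy
    rw [hμdef, div_mul_eq_mul_div, div_le_iff₀ hpos]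
    exact this
  have hleast : IsLeast G.eigenvalues μ := by
    refine ⟨isEigenvalue_of_weak hx hpos fun y hy => energyForm_eq_of_minimizer hμ hx hxμ hy, ?_⟩
    intro ρ hρ
    obtain ⟨y, hy, hypos, hyρ⟩ := IsEigenvalue.exists_mem_formDomain hρ
    have := hμ y hy
    rw [hyρ] at this
    exact le_of_mul_le_mul_right this hypos
  have : G.groundEnergy = μ := hleast.csInf_eq
  rw [this]
  exact ⟨hleast, hμ, x, hx, hpos, hxμ⟩

end QuantumGraph

/-! ### One-sided derivatives at zeros, and a limit of weighted integrals -/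

section

open Filter Topology

variable {a b : ℝ} {u u' : ℝ → ℝ}

/-- If `u'` were negative at the zero, it would stay negative just to the right by continuity, and
integrating would make `u` negative. The left end is included; at an interior zero, the mirror
statement `IsAC.deriv_nonpos_of_eq_zero` makes the derivative vanish. -/
theorem IsAC.deriv_nonneg_of_eq_zero (hu : IsAC a b u u') (hu' : ContinuousOn u' (Icc a b))
    (hnn : ∀ t ∈ Icc a b, 0 ≤ u t) {x : ℝ} (hx : x ∈ Ico a b) (h0 : u x = 0) : 0 ≤ u' x := by
  by_contra! hneg
  have hxI : x ∈ Icc a b := Ico_subset_Icc_self hx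
  have h1 := (hu' x hxI).eventually (gt_mem_nhds hneg)
  obtain ⟨δ, hδ, h2⟩ := Metric.mem_nhdsWithin_iff.1 h1
  set y := min b (x + δ / 2)
  have hxy : x < y := lt_min hx.2 (by linarith)
  have hyI : y ∈ Icc a b := ⟨hx.1.trans hxy.le, min_le_left _ _⟩
  have h3 := intervalIntegral.intervalIntegral_pos_of_pos_on (hu.intervalIntegrable hxI hyI).neg
    (fun t ht => neg_pos.2 (h2 ⟨by
      rw [Metric.mem_ball, Real.dist_eq, abs_of_pos (sub_pos.2 ht.1)]
      linarith [min_le_right b (x + δ / 2), ht.2], hx.1.trans ht.1.le, ht.2.le.trans hyI.2⟩)) hxy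
  simp only [Pi.neg_apply] at h3
  rw [intervalIntegral.integral_neg, ← hu.sub_eq hxI hyI, h0] at h3
  linarith [hnn y hyI]

theorem IsAC.deriv_nonpos_of_eq_zero (hu : IsAC a b u u') (hu' : ContinuousOn u' (Icc a b))
    (hnn : ∀ t ∈ Icc a b, 0 ≤ u t) {x : ℝ} (hx : x ∈ Ioc a b) (h0 : u x = 0) : u' x ≤ 0 := by
  by_contra! hpos
  have hxI : x ∈ Icc a b := Ioc_subset_Icc_self hx
  have h1 := (hu' x hxI).eventually (lt_mem_nhds hpos)
  obtain ⟨δ, hδ, h2⟩ := Metric.mem_nhdsWithin_iff.1 h1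
  set y := max a (x - δ / 2)
  have hxy : y < x := max_lt hx.1 (by linarith)
  have hyI : y ∈ Icc a b := ⟨le_max_left _ _, hxy.le.trans hx.2⟩
  have h3 := intervalIntegral.intervalIntegral_pos_of_pos_on (hu.intervalIntegrable hyI hxI)
    (fun t ht => h2 ⟨by
      rw [Metric.mem_ball, Real.dist_eq, abs_of_neg (sub_neg.2 ht.2)]
      linarith [le_max_right a (x - δ / 2), ht.1], hyI.1.trans ht.1.le, ht.2.le.trans hx.2⟩) hxy
  rw [← hu.sub_eq hyI hxI, h0] at h3
  linarith [hnn y hyI]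

/-- Continuity of a weighted quadratic integral under a small change of the interval and of the
function. -/
theorem tendsto_integral_weighted_sq (hab : a < b) {q u : ℝ → ℝ}
    (hq : IntervalIntegrable q volume a b)
    (hu : AEStronglyMeasurable u (volume.restrict (Icc a b)))
    (hqu : IntervalIntegrable (fun t => q t * (u t * u t)) volume a b)
    {ℓ : ℝ × ℝ → ℝ → ℝ} (hℓ : ∀ p, Continuous (ℓ p)) {η : ℝ × ℝ → ℝ}
    (hη : Tendsto η (𝓝[{p | a ≤ p.1 ∧ p.1 < p.2 ∧ p.2 ≤ b}] (a, b)) (𝓝 0))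
    (hℓη : ∀ p ∈ {p : ℝ × ℝ | a ≤ p.1 ∧ p.1 < p.2 ∧ p.2 ≤ b}, ∀ t ∈ Icc a b, |ℓ p t| ≤ η p) :
    Tendsto (fun p : ℝ × ℝ => ∫ t in p.1..p.2, q t * ((u t - ℓ p t) * (u t - ℓ p t)))
      (𝓝[{p | a ≤ p.1 ∧ p.1 < p.2 ∧ p.2 ≤ b}] (a, b)) (𝓝 (∫ t in a..b, q t * (u t * u t))) := by
  set S : Set (ℝ × ℝ) := {p | a ≤ p.1 ∧ p.1 < p.2 ∧ p.2 ≤ b} with hS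
  have hmem : ∀ᶠ p in 𝓝[S] (a, b), p ∈ S := eventually_mem_nhdsWithin
  have hu' : AEStronglyMeasurable u (volume.restrict (Ioc a b)) :=
    hu.mono_measure (Measure.restrict_mono Ioc_subset_Icc_self le_rfl)
  have hq' : IntegrableOn q (Ioc a b) := (intervalIntegrable_iff_integrableOn_Ioc_of_le hab.le).1 hq
  have hqu' := (intervalIntegrable_iff_integrableOn_Ioc_of_le hab.le).1 hqu
  -- The moving limits of integration are absorbed into an indicator, so dominated convergence
  -- applies on the fixed interval. The point `b` is discarded because it lies outside every
  -- interval with `p.2 < b`.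
  have key : Tendsto (fun p : ℝ × ℝ => ∫ t in Ioc a b, (Ioc p.1 p.2).indicator
      (fun t => q t * ((u t - ℓ p t) * (u t - ℓ p t))) t) (𝓝[S] (a, b))
      (𝓝 (∫ t in Ioc a b, q t * (u t * u t))) := by
    refine tendsto_integral_filter_of_dominated_convergence
      (fun t => 2 * |q t * (u t * u t)| + 2 * |q t|) ?_ ?_ ?_ ?_
    · refine .of_forall fun p => AEStronglyMeasurable.indicator ?_ measurableSet_Ioc
      have h1 : AEStronglyMeasurable (ℓ p) (volume.restrict (Ioc a b)) :=
        (hℓ p).aestronglyMeasurable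
      exact hq'.aestronglyMeasurable.mul ((hu'.sub h1).mul (hu'.sub h1))
    · filter_upwards [hmem, hη.eventually (gt_mem_nhds one_pos)] with p hp hp1
      rw [ae_restrict_iff' measurableSet_Ioc]
      refine .of_forall fun t ht => ?_
      have hl : |ℓ p t| ≤ 1 := (hℓη p hp t (Ioc_subset_Icc_self ht)).trans hp1.le
      refine (norm_indicator_le_norm_self _ _).trans ?_
      rw [Real.norm_eq_abs, abs_mul, abs_mul (q t), abs_mul_self, abs_mul_self]
      have h2 : (u t - ℓ p t) * (u t - ℓ p t) ≤ 2 * (u t * u t) + 2 * 1 := by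
        have := abs_le.1 hl
        nlinarith [mul_self_nonneg (u t + ℓ p t)]
      nlinarith [mul_le_mul_of_nonneg_left h2 (abs_nonneg (q t))]
    · exact (hqu'.abs.const_mul 2).add (hq'.abs.const_mul 2)
    · rw [ae_restrict_iff' measurableSet_Ioc]
      filter_upwards [compl_mem_ae_iff.2 (measure_singleton b)] with t htb ht
      have htb : t < b := lt_of_le_of_ne ht.2 htb
      have hl : Tendsto (fun p => ℓ p t) (𝓝[S] (a, b)) (𝓝 0) := by
        refine squeeze_zero_norm' ?_ hη
        filter_upwards [hmem] with p hp
        exact hℓη p hp t (Ioc_subset_Icc_self ht)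
      have h3 : Tendsto (fun p => q t * ((u t - ℓ p t) * (u t - ℓ p t))) (𝓝[S] (a, b))
          (𝓝 (q t * (u t * u t))) := by
        simpa using ((hl.const_sub (u t)).mul (hl.const_sub (u t))).const_mul (q t)
      refine h3.congr' ?_
      have e1 : ∀ᶠ p : ℝ × ℝ in 𝓝[S] (a, b), p.1 < t :=
        (continuous_fst.tendsto (a, b)).mono_left nhdsWithin_le_nhds |>.eventually (gt_mem_nhds ht.1)
      have e2 : ∀ᶠ p : ℝ × ℝ in 𝓝[S] (a, b), t < p.2 :=
        (continuous_snd.tendsto (a, b)).mono_left nhdsWithin_le_nhds |>.eventually (lt_mem_nhds htb)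
      filter_upwards [e1, e2] with p h1 h2
      rw [indicator_of_mem (show t ∈ Ioc p.1 p.2 from ⟨h1, h2.le⟩)]
  rw [intervalIntegral.integral_of_le hab.le]
  refine key.congr' ?_
  filter_upwards [hmem] with p hp
  rw [setIntegral_indicator measurableSet_Ioc, intervalIntegral.integral_of_le hp.2.1.le,
    inter_eq_right.2 (Ioc_subset_Ioc hp.1 hp.2.2)]

end

/-! ### Dependence of the lowest eigenvalue on the lengths of the edges -/

namespace QuantumGraph

variable {V E : Type*}

/-- Two quantum graphs with the same combinatorial structure, vertex conditions and potential,
that may differ in the coordinates of the ends of the edges. -/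
structure SameData (G G' : QuantumGraph V E) : Prop where
  src : G'.src = G.src
  tgt : G'.tgt = G.tgt
  pot : G'.pot = G.pot
  coupling : G'.coupling = G.coupling

variable {G G' : QuantumGraph V E}

theorem SameData.eq (h : SameData G G') (hlo : G'.lo = G.lo) (hhi : G'.hi = G.hi) : G' = G := by
  obtain ⟨h1, h2, h3, h4⟩ := h
  cases G
  cases G'
  simp only at h1 h2 h3 h4 hlo hhi
  subst h1 h2 h3 h4 hlo hhi
  rfl

variable [Fintype E]

theorem SameData.ends_eq (h : SameData G G') : G'.ends = G.ends := by
  rw [ends, ends, h.src, h.tgt]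

omit [Fintype E] in
theorem SameData.strength_eq (h : SameData G G') : G'.strength = G.strength := by
  funext v
  rw [strength, strength, h.coupling]

/-- A nonnegative solution on a connected graph that vanishes on an edge is zero. -/
theorem eq_zero_of_nonneg_of_connected (hG : G.Connected) {μ : ℝ}
    {x : (E → ℝ → ℝ) × (E → ℝ → ℝ) × (V → ℝ)} (hx : x ∈ G.formDomain) {f' : E → ℝ → ℝ}
    (hf' : ∀ e, IsH2 (G.lo e) (G.hi e) (x.1 e) (f' e) fun t => (G.pot e t - μ) * x.1 e t)
    (hv : ∀ v ∈ G.ends, G.coupling v ≠ ⊤ → G.outgoingSum f' v = G.strength v * x.2.2 v)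
    (hnn : ∀ e, ∀ t ∈ Icc (G.lo e) (G.hi e), 0 ≤ x.1 e t)
    (h0 : ∃ e, ∃ t ∈ Icc (G.lo e) (G.hi e), x.1 e t = 0 ∧ f' e t = 0) (e : E) :
    ∀ t ∈ Icc (G.lo e) (G.hi e), x.1 e t = 0 := by
  classical
  have hlt := G.lo_lt_hi
  have ac : ∀ e, IsAC (G.lo e) (G.hi e) (x.1 e) (f' e) := fun e => (hf' e).isH1.isAC (hlt e).le
  have hc : ∀ e, ContinuousOn (f' e) (Icc (G.lo e) (G.hi e)) :=
    fun e => (hf' e).isH1_deriv.continuousOn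
  have zero_of : ∀ e, (∃ t ∈ Icc (G.lo e) (G.hi e), x.1 e t = 0 ∧ f' e t = 0) →
      ∀ t ∈ Icc (G.lo e) (G.hi e), x.1 e t = 0 := by
    rintro e ⟨t, ht, h1, h2⟩ s hs
    obtain ⟨M, hM⟩ := G.pot_bounded e
    refine ((ac e).eq_zero_of_eq_zero_at ((hf' e).isH1_deriv.isAC (hlt e).le) (K := M + |μ|)
      ?_ ht h1 h2 s hs).1
    rw [ae_restrict_iff' measurableSet_Icc]
    refine .of_forall fun r hr => ?_
    rw [abs_mul]
    gcongr
    exact (abs_sub _ _).trans (add_le_add_left (hM r hr) _)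
  -- At a shared vertex the value is zero, so every outgoing derivative is nonnegative; the vertex
  -- condition makes their sum zero, hence each of them vanishes. This is zero initial data on every
  -- edge at that vertex.
  have step : ∀ e e', G.Linked e e' → (∀ t ∈ Icc (G.lo e) (G.hi e), x.1 e t = 0) →
      ∀ t ∈ Icc (G.lo e') (G.hi e'), x.1 e' t = 0 := by
    rintro e e' ⟨v, hvD, he, he'⟩ hz
    have hve : v ∈ G.ends := G.mem_ends.2 ⟨e, he⟩
    have hφ : x.2.2 v = 0 := by
      rcases he with rfl | rfl
      · rw [← (hx.2.1 e).1]
        exact hz _ (left_mem_Icc.2 (hlt e).le)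
      · rw [← (hx.2.1 e).2]
        exact hz _ (right_mem_Icc.2 (hlt e).le)
    have hs : ∀ k, G.src k = v → x.1 k (G.lo k) = 0 ∧ 0 ≤ f' k (G.lo k) := fun k hk => by
      have h1 : x.1 k (G.lo k) = 0 := by rw [(hx.2.1 k).1, hk, hφ]
      exact ⟨h1, (ac k).deriv_nonneg_of_eq_zero (hc k) (hnn k) ⟨le_rfl, hlt k⟩ h1⟩
    have ht : ∀ k, G.tgt k = v → x.1 k (G.hi k) = 0 ∧ 0 ≤ -f' k (G.hi k) := fun k hk => by
      have h1 : x.1 k (G.hi k) = 0 := by rw [(hx.2.1 k).2, hk, hφ]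
      exact ⟨h1, neg_nonneg.2
        ((ac k).deriv_nonpos_of_eq_zero (hc k) (hnn k) ⟨hlt k, le_rfl⟩ h1)⟩
    have n1 : ∀ k, 0 ≤ if G.src k = v then f' k (G.lo k) else 0 := fun k => by
      split_ifs with h
      · exact (hs k h).2
      · exact le_rfl
    have n2 : ∀ k, 0 ≤ if G.tgt k = v then -f' k (G.hi k) else 0 := fun k => by
      split_ifs with h
      · exact (ht k h).2
      · exact le_rfl
    have hsum := hv v hve hvD
    rw [hφ, mul_zero, outgoingSum, Finset.sum_eq_zero_iff_of_nonneg
      fun k _ => add_nonneg (by convert n1 k) (by convert n2 k)] at hsum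
    have hk := hsum e' (Finset.mem_univ _)
    rw [add_eq_zero_iff_of_nonneg (by convert n1 e') (by convert n2 e')] at hk
    refine zero_of e' ?_
    rcases he' with he' | he'
    · have := hk.1
      rw [if_pos he'] at this
      exact ⟨_, left_mem_Icc.2 (hlt e').le, (hs e' he').1, this⟩
    · have := hk.2
      rw [if_pos he', neg_eq_zero] at this
      exact ⟨_, right_mem_Icc.2 (hlt e').le, (ht e' he').1, this⟩
  obtain ⟨e₀, h0⟩ := h0
  have hchain : ∀ e e', Relation.EqvGen G.Linked e e' →
      ((∀ t ∈ Icc (G.lo e) (G.hi e), x.1 e t = 0) ↔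
        ∀ t ∈ Icc (G.lo e') (G.hi e'), x.1 e' t = 0) := by
    intro e e' h
    induction h with
    | rel e e' h =>
      exact ⟨step e e' h, step e' e (by obtain ⟨v, h1, h2, h3⟩ := h; exact ⟨v, h1, h3, h2⟩)⟩
    | refl => exact Iff.rfl
    | symm _ _ _ ih => exact ih.symm
    | trans _ _ _ _ _ ih ih' => exact ih.trans ih'
  exact (hchain e₀ e (hG e₀ e)).1 (zero_of e₀ h0)

/-- The lowest eigenvalue decreases strictly if a connected graph is enlarged at Dirichlet
vertices. -/
theorem SameData.groundEnergy_lt [Finite V] (h : SameData G G') (hG : G'.Connected)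
    (hlo : ∀ e, G'.lo e ≤ G.lo e) (hhi : ∀ e, G.hi e ≤ G'.hi e)
    (hloD : ∀ e, G'.lo e < G.lo e → G.coupling (G.src e) = ⊤)
    (hhiD : ∀ e, G.hi e < G'.hi e → G.coupling (G.tgt e) = ⊤)
    (hne : ∃ e, G'.lo e < G.lo e ∨ G.hi e < G'.hi e) :
    G'.groundEnergy < G.groundEnergy := by
  have hE : Nonempty E := hne.nonempty
  obtain ⟨-, -, x, hx, hpos, hmin⟩ := isLeast_groundEnergy_and_le (G := G)
  obtain ⟨-, hle', -⟩ := isLeast_groundEnergy_and_le (G := G')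
  have hlt := G.lo_lt_hi
  choose k hk hkle using fun e => (hx.1 e).abs (hlt e).le
  have hsub : ∀ e, Icc (G.lo e) (G.hi e) ⊆ Icc (G'.lo e) (G'.hi e) :=
    fun e => Icc_subset_Icc (hlo e) (hhi e)
  -- The absolute value of a ground state, extended by zero. It is admissible because ends move only
  -- at Dirichlet vertices, where the ground state is zero.
  set y : (E → ℝ → ℝ) × (E → ℝ → ℝ) × (V → ℝ) :=
    (fun e => (Icc (G.lo e) (G.hi e)).indicator fun t => |x.1 e t|,
      fun e => (Icc (G.lo e) (G.hi e)).indicator (k e), fun v => |x.2.2 v|) with hydef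
  have hend : ∀ e, x.1 e (G.lo e) = x.2.2 (G.src e) ∧ x.1 e (G.hi e) = x.2.2 (G.tgt e) := hx.2.1
  have hy : y ∈ G'.formDomain := by
    refine ⟨fun e => (hk e).indicator (hlt e).le (hlo e) (hhi e) (fun h1 => ?_) (fun h1 => ?_),
      fun e => ⟨?_, ?_⟩, fun v hv => ?_⟩
    · rw [(hend e).1, hx.2.2 _ (hloD e h1), abs_zero]
    · rw [(hend e).2, hx.2.2 _ (hhiD e h1), abs_zero]
    · simp only [hydef, h.src]
      rcases (hlo e).lt_or_eq with h1 | h1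
      · rw [hx.2.2 _ (hloD e h1), abs_zero, indicator_of_notMem fun h2 => h1.not_ge h2.1]
      · rw [h1, indicator_of_mem (left_mem_Icc.2 (hlt e).le), (hend e).1]
    · simp only [hydef, h.tgt]
      rcases (hhi e).lt_or_eq with h1 | h1
      · rw [hx.2.2 _ (hhiD e h1), abs_zero, indicator_of_notMem fun h2 => h1.not_ge h2.2]
      · rw [← h1, indicator_of_mem (right_mem_Icc.2 (hlt e).le), (hend e).2]
    · rw [h.coupling] at hv
      simp [hydef, hx.2.2 v hv]
  have hint : ∀ e (q : ℝ → ℝ), ∫ t in (G'.lo e)..(G'.hi e),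
      (Icc (G.lo e) (G.hi e)).indicator q t = ∫ t in (G.lo e)..(G.hi e), q t := by
    intro e q
    rw [intervalIntegral.integral_of_le (G'.lo_lt_hi e).le,
      intervalIntegral.integral_of_le (hlt e).le, ← integral_Icc_eq_integral_Ioc,
      ← integral_Icc_eq_integral_Ioc, setIntegral_indicator measurableSet_Icc,
      inter_eq_right.2 (hsub e)]
  have hmass : G'.massForm y y = G.massForm x x := by
    refine Finset.sum_congr rfl fun e _ => ?_
    rw [← hint e]
    refine intervalIntegral.integral_congr fun t _ => ?_
    by_cases ht : t ∈ Icc (G.lo e) (G.hi e)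
    · simp [hydef, indicator_of_mem ht]
    · simp [hydef, indicator_of_notMem ht]
  have henergy : G'.energyForm y y ≤ G.energyForm x x := by
    simp only [energyForm, h.ends_eq, h.strength_eq]
    refine add_le_add (Finset.sum_le_sum fun e _ => ?_) (Finset.sum_le_sum fun v _ => ?_)
    · have e1 : (∫ t in (G'.lo e)..(G'.hi e), (y.2.1 e t * y.2.1 e t +
          G'.pot e t * (y.1 e t * y.1 e t))) =
          ∫ t in (G.lo e)..(G.hi e), (k e t * k e t + G.pot e t * (x.1 e t * x.1 e t)) := by
        rw [← hint e]
        refine intervalIntegral.integral_congr fun t _ => ?_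
        by_cases ht : t ∈ Icc (G.lo e) (G.hi e)
        · simp [hydef, indicator_of_mem ht, h.pot]
        · simp [hydef, indicator_of_notMem ht]
      rw [e1]
      have i1 := intervalIntegrable_mul_mul hx hx (G.pot_intervalIntegrable e)
      have i2 := (hk e).memLp.intervalIntegrable_mul_Icc (hlt e).le (hk e).memLp
      refine intervalIntegral.integral_mono_ae_restrict (hlt e).le (i2.add i1)
        ((intervalIntegrable_deriv_mul_deriv hx hx e).add i1) ?_
      filter_upwards [hkle e] with t ht
      have := abs_le_iff_mul_self_le.1 ht
      simpa using this
    · simp [hydef]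
  have hle := hle' y hy
  -- If the energy did not drop, `y` would minimize the quotient on the larger graph and so solve
  -- the equation there, while vanishing at an interior point of an added piece.
  refine lt_of_not_ge fun hcon => ?_
  have heq : G'.energyForm y y = G'.groundEnergy * G'.massForm y y := by
    refine le_antisymm (henergy.trans ?_) hle
    rw [hmin, hmass]
    gcongr
  obtain ⟨f', hf', hv⟩ := exists_isH2_of_weak hy
    fun z hz => energyForm_eq_of_minimizer hle' hy heq hz
  have hnn : ∀ e t, 0 ≤ y.1 e t := fun e t => indicator_nonneg (fun _ _ => abs_nonneg _) _
  have hvan : ∃ e, ∃ t ∈ Ioo (G'.lo e) (G'.hi e), y.1 e t = 0 := by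
    obtain ⟨e, he⟩ := hne
    rcases he with he | he
    · refine ⟨e, (G'.lo e + G.lo e) / 2, ⟨by linarith, by linarith [hlt e, hhi e]⟩, ?_⟩
      have hnot : (G'.lo e + G.lo e) / 2 ∉ Icc (G.lo e) (G.hi e) := fun h1 => by linarith [h1.1]
      simp only [hydef, indicator_of_notMem hnot]
    · refine ⟨e, (G.hi e + G'.hi e) / 2, ⟨by linarith [hlt e, hlo e], by linarith⟩, ?_⟩
      have hnot : (G.hi e + G'.hi e) / 2 ∉ Icc (G.lo e) (G.hi e) := fun h1 => by linarith [h1.2]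
      simp only [hydef, indicator_of_notMem hnot]
  obtain ⟨e, t, ht, hyt⟩ := hvan
  have hac := (hf' e).isH1.isAC (G'.lo_lt_hi e).le
  have hc := (hf' e).isH1_deriv.continuousOn
  have hft : f' e t = 0 := le_antisymm
    (hac.deriv_nonpos_of_eq_zero hc (fun s _ => hnn e s) (Ioo_subset_Ioc_self ht) hyt)
    (hac.deriv_nonneg_of_eq_zero hc (fun s _ => hnn e s) (Ioo_subset_Ico_self ht) hyt)
  have hzero := eq_zero_of_nonneg_of_connected hG hy hf' hv (fun e s _ => hnn e s)
    ⟨e, t, Ioo_subset_Icc_self ht, hyt, hft⟩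
  rw [← hmass] at hpos
  refine hpos.ne' (Finset.sum_eq_zero fun e _ => ?_)
  rw [intervalIntegral.integral_congr (g := fun _ => 0), intervalIntegral.integral_zero]
  intro s hs
  rw [uIcc_of_le (G'.lo_lt_hi e).le] at hs
  simp [hzero e s hs]

open Filter Topology in
/-- The lowest eigenvalue is upper semicontinuous if the edges are shortened. -/
theorem exists_groundEnergy_lt [Finite V] [Nonempty E] {Λ : ℝ} (hΛ : G.groundEnergy < Λ) :
    ∃ δ > 0, ∀ G' : QuantumGraph V E, SameData G G' →
      (∀ e, G.lo e ≤ G'.lo e ∧ G'.lo e < G.lo e + δ) →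
      (∀ e, G'.hi e ≤ G.hi e ∧ G.hi e - δ < G'.hi e) → G'.groundEnergy < Λ := by
  obtain ⟨-, -, x, hx, hpos, hmin⟩ := isLeast_groundEnergy_and_le (G := G)
  have hlt := G.lo_lt_hi
  -- A pair `p` in `S e` holds the ends of a shortened edge. The linear function `ℓ e p`, with
  -- initial value `d e p` and slope `c e p`, is the correction that restores the original vertex
  -- values at the new ends. It tends to zero with the displacement, and `D e p` is the contribution
  -- of the edge to energy minus `Λ` times mass for the corrected function.
  set S : E → Set (ℝ × ℝ) := fun e => {p | G.lo e ≤ p.1 ∧ p.1 < p.2 ∧ p.2 ≤ G.hi e} with hS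
  set d : E → ℝ × ℝ → ℝ := fun e p => x.1 e p.1 - x.1 e (G.lo e) with hd
  set c : E → ℝ × ℝ → ℝ := fun e p =>
    ((x.1 e p.2 - x.1 e (G.hi e)) - (x.1 e p.1 - x.1 e (G.lo e))) / (p.2 - p.1) with hc
  set ℓ : E → ℝ × ℝ → ℝ → ℝ := fun e p t => d e p + c e p * (t - p.1) with hℓ
  set D : E → ℝ × ℝ → ℝ := fun e p =>
    (∫ t in p.1..p.2, 1 * ((x.2.1 e t - c e p) * (x.2.1 e t - c e p))) +
    ∫ t in p.1..p.2, (G.pot e t - Λ) * ((x.1 e t - ℓ e p t) * (x.1 e t - ℓ e p t)) with hD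
  have hqi : ∀ e, IntervalIntegrable (fun t => G.pot e t - Λ) volume (G.lo e) (G.hi e) := fun e =>
    (G.pot_intervalIntegrable e).sub intervalIntegrable_const
  have hlim : ∀ e, Tendsto (D e) (𝓝[S e] (G.lo e, G.hi e))
      (𝓝 ((∫ t in (G.lo e)..(G.hi e), 1 * (x.2.1 e t * x.2.1 e t)) +
        ∫ t in (G.lo e)..(G.hi e), (G.pot e t - Λ) * (x.1 e t * x.1 e t))) := by
    intro e
    have hcont := (hx.1 e).continuousOn
    have t1 : Tendsto (fun p : ℝ × ℝ => x.1 e p.1) (𝓝[S e] (G.lo e, G.hi e))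
        (𝓝 (x.1 e (G.lo e))) :=
      (hcont _ (left_mem_Icc.2 (hlt e).le)).tendsto.comp
        (continuous_fst.continuousWithinAt.tendsto_nhdsWithin
          fun p (hp : p ∈ S e) => ⟨hp.1, hp.2.1.le.trans hp.2.2⟩)
    have t2 : Tendsto (fun p : ℝ × ℝ => x.1 e p.2) (𝓝[S e] (G.lo e, G.hi e))
        (𝓝 (x.1 e (G.hi e))) :=
      (hcont _ (right_mem_Icc.2 (hlt e).le)).tendsto.comp
        (continuous_snd.continuousWithinAt.tendsto_nhdsWithin
          fun p (hp : p ∈ S e) => ⟨hp.1.trans hp.2.1.le, hp.2.2⟩)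
    have t3 : Tendsto (fun p : ℝ × ℝ => p.2 - p.1) (𝓝[S e] (G.lo e, G.hi e))
        (𝓝 (G.hi e - G.lo e)) :=
      ((continuous_snd.sub continuous_fst).tendsto _).mono_left nhdsWithin_le_nhds
    have hd0 : Tendsto (d e) (𝓝[S e] (G.lo e, G.hi e)) (𝓝 0) := by
      simpa [hd] using t1.sub_const (x.1 e (G.lo e))
    have hc0 : Tendsto (c e) (𝓝[S e] (G.lo e, G.hi e)) (𝓝 0) := by
      have := ((t2.sub_const (x.1 e (G.hi e))).sub (t1.sub_const (x.1 e (G.lo e)))).div t3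
        (sub_ne_zero.2 (hlt e).ne')
      rw [sub_self, sub_self, sub_self, zero_div] at this
      exact this
    refine Tendsto.add ?_ ?_
    · refine tendsto_integral_weighted_sq (ℓ := fun p _ => c e p) (hlt e) intervalIntegrable_const
        (hx.1 e).memLp.aestronglyMeasurable ?_ (fun p => continuous_const) (η := fun p => |c e p|)
        (by simpa using hc0.abs) (fun p _ t _ => le_rfl)
      simpa using intervalIntegrable_deriv_mul_deriv hx hx e
    · refine tendsto_integral_weighted_sq (ℓ := ℓ e) (hlt e) (hqi e)
        (hcont.aestronglyMeasurable measurableSet_Icc) (intervalIntegrable_mul_mul hx hx (hqi e))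
        (fun p => by fun_prop) (η := fun p => |d e p| + |c e p| * (G.hi e - G.lo e))
        (by simpa using hd0.abs.add (hc0.abs.mul_const (G.hi e - G.lo e))) (fun p hp t ht => ?_)
      refine (abs_add_le _ _).trans (add_le_add_right ?_ _)
      rw [abs_mul]
      gcongr
      rw [abs_le]
      constructor <;> linarith [hp.1, hp.2.1, hp.2.2, ht.1, ht.2]
  set B : ℝ := ∑ v ∈ G.ends, G.strength v * (x.2.2 v * x.2.2 v) with hB
  -- Without displacement, energy minus `Λ` times mass of the ground state is negative, and this
  -- strict sign survives small displacements. A negative value on the shortened graph is exactly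
  -- what keeps its lowest eigenvalue below `Λ`.
  have hneg : ∑ e, ((∫ t in (G.lo e)..(G.hi e), 1 * (x.2.1 e t * x.2.1 e t)) +
        ∫ t in (G.lo e)..(G.hi e), (G.pot e t - Λ) * (x.1 e t * x.1 e t)) + B < 0 := by
    have h1 : G.energyForm x x - Λ * G.massForm x x < 0 := by
      rw [hmin]
      nlinarith
    have h2 : G.energyForm x x - Λ * G.massForm x x =
        ∑ e, ((∫ t in (G.lo e)..(G.hi e), 1 * (x.2.1 e t * x.2.1 e t)) +
        ∫ t in (G.lo e)..(G.hi e), (G.pot e t - Λ) * (x.1 e t * x.1 e t)) + B := by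
      simp only [energyForm, massForm]
      rw [Finset.mul_sum, add_sub_right_comm, ← Finset.sum_sub_distrib]
      congr 1
      refine Finset.sum_congr rfl fun e _ => ?_
      have i1 := intervalIntegrable_deriv_mul_deriv hx hx e
      rw [← intervalIntegral.integral_const_mul, ← intervalIntegral.integral_sub
        (i1.add (intervalIntegrable_mul_mul hx hx (G.pot_intervalIntegrable e)))
        ((intervalIntegrable_mul hx hx e).const_mul Λ), ← intervalIntegral.integral_add
        (by simpa using i1) (intervalIntegrable_mul_mul hx hx (hqi e))]
      refine intervalIntegral.integral_congr fun t _ => ?_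
      ring
    rwa [← h2]
  have htot : Tendsto (fun P : E → ℝ × ℝ => ∑ e, D e (P e) + B)
      (𝓝[univ.pi S] fun e => (G.lo e, G.hi e))
      (𝓝 (∑ e, ((∫ t in (G.lo e)..(G.hi e), 1 * (x.2.1 e t * x.2.1 e t)) +
        ∫ t in (G.lo e)..(G.hi e), (G.pot e t - Λ) * (x.1 e t * x.1 e t)) + B)) := by
    refine Tendsto.add_const _ (tendsto_finsetSum _ fun e _ => (hlim e).comp ?_)
    exact (continuous_apply e).continuousWithinAt.tendsto_nhdsWithin
      fun P (hP : P ∈ univ.pi S) => hP e (mem_univ _)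
  obtain ⟨δ, hδ, hsub⟩ := Metric.mem_nhdsWithin_iff.1 (htot.eventually (gt_mem_nhds hneg))
  refine ⟨δ, hδ, fun G' h hlo hhi => ?_⟩
  have hP : ∑ e, D e (G'.lo e, G'.hi e) + B < 0 := by
    refine hsub (a := fun e => (G'.lo e, G'.hi e)) ⟨?_, fun e _ => ⟨(hlo e).1, G'.lo_lt_hi e, (hhi e).1⟩⟩
    rw [Metric.mem_ball, dist_pi_lt_iff hδ]
    intro e
    rw [Prod.dist_eq, max_lt_iff, Real.dist_eq, Real.dist_eq, abs_lt, abs_lt]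
    have h1 := hlo e
    have h2 := hhi e
    refine ⟨⟨?_, ?_⟩, ?_, ?_⟩ <;> dsimp only <;> linarith
  set y : (E → ℝ → ℝ) × (E → ℝ → ℝ) × (V → ℝ) :=
    (fun e t => x.1 e t + (-1) * ℓ e (G'.lo e, G'.hi e) t,
      fun e t => x.2.1 e t + (-1) * c e (G'.lo e, G'.hi e), x.2.2) with hydef
  have hy : y ∈ G'.formDomain := by
    refine ⟨fun e => ((hx.1 e).mono (hlo e).1 (hhi e).1).add ((IsH1.linear _ _ _).const_mul _),
      fun e => ⟨?_, ?_⟩, fun v hv => hx.2.2 v (h.coupling ▸ hv)⟩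
    · rw [h.src]
      simp only [hydef, hℓ, hd]
      rw [← (hx.2.1 e).1]
      ring
    · rw [h.tgt]
      simp only [hydef, hℓ, hd, hc]
      rw [← (hx.2.1 e).2, div_mul_cancel₀ _ (sub_ne_zero.2 (G'.lo_lt_hi e).ne')]
      ring
  have hval : G'.energyForm y y - Λ * G'.massForm y y = ∑ e, D e (G'.lo e, G'.hi e) + B := by
    simp only [energyForm, massForm, h.ends_eq, h.strength_eq]
    rw [Finset.mul_sum, add_sub_right_comm, ← Finset.sum_sub_distrib]
    congr 1
    refine Finset.sum_congr rfl fun e _ => ?_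
    have i1 := intervalIntegrable_deriv_mul_deriv hy hy e
    have i2 := intervalIntegrable_mul_mul hy hy (G'.pot_intervalIntegrable e)
    have i3 := (intervalIntegrable_mul hy hy e).const_mul Λ
    rw [← intervalIntegral.integral_const_mul, ← intervalIntegral.integral_sub (i1.add i2) i3]
    simp only [hD]
    rw [← intervalIntegral.integral_add]
    · refine intervalIntegral.integral_congr fun t _ => ?_
      simp only [hydef, h.pot]
      ring
    · refine i1.congr fun t _ => ?_
      simp only [hydef]
      ring
    · refine (i2.sub i3).congr fun t _ => ?_
      simp only [hydef, h.pot]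
      ring
  have h1 := (isLeast_groundEnergy_and_le (G := G')).2.1 y hy
  have h2 := G'.massForm_nonneg y
  by_contra! hcon
  nlinarith

end QuantumGraph

/-! ### Moving one partition point -/

namespace QuantumGraph

/-- Every intermediate edge of a chain is equivalent to its first edge, so the chain never leaves
the component. -/
theorem connected_subgraph {V E : Type*} (G : QuantumGraph V E) (c : G.Component) :
    (G.subgraph c).Connected := by
  have key : ∀ e e', Relation.EqvGen G.Linked e e' →
      ∀ (he : Quotient.mk G.linkSetoid e = c) (he' : Quotient.mk G.linkSetoid e' = c),
        Relation.EqvGen (G.subgraph c).Linked ⟨e, he⟩ ⟨e', he'⟩ := by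
    intro e e' h
    induction h with
    | rel e e' h => exact fun _ _ => .rel _ _ h
    | refl => exact fun _ _ => .refl _
    | symm _ _ _ ih => exact fun h1 h2 => (ih h2 h1).symm
    | trans x y z hxy _ ih ih' =>
      intro h1 h2
      have hy : Quotient.mk G.linkSetoid y = c := by
        rw [← h1]
        exact Quotient.sound hxy.symm
      exact (ih h1 hy).trans _ _ _ (ih' hy h2)
  rintro ⟨e, he⟩ ⟨e', he'⟩
  exact key e e' (Quotient.exact (he.trans he'.symm)) he he'

namespace Partition

variable {V E : Type*} [Fintype E] {G : QuantumGraph V E} {m : ℕ} (P : G.Partition m)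

/-- The segment that ends at a partition vertex. -/
def leftSegment (p : P.Vertex) : P.Segment := ⟨p.1, p.2.castSucc⟩

/-- The segment that starts at a partition vertex. -/
def rightSegment (p : P.Vertex) : P.Segment := ⟨p.1, p.2.succ⟩

/-- The subgraph that contains a segment. -/
def partOf (q : P.Segment) : P.Part := Quotient.mk P.divided.linkSetoid q

theorem coupling_tgt_leftSegment (p : P.Vertex) :
    P.divided.coupling (P.divided.tgt (P.leftSegment p)) = ⊤ := by
  simp [divided, leftSegment]

theorem coupling_src_rightSegment (p : P.Vertex) :
    P.divided.coupling (P.divided.src (P.rightSegment p)) = ⊤ := by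
  simp [divided, rightSegment]

/-- The partition obtained by moving one partition vertex. -/
abbrev move [DecidableEq E] (p : P.Vertex) (s : ℝ) (h₁ : P.t p.1 p.2.castSucc.castSucc < s)
    (h₂ : s < P.t p.1 p.2.succ.succ) : G.Partition m where
  n := P.n
  t := Function.update P.t p.1 (Function.update (P.t p.1) p.2.succ.castSucc s)
  strictMono e := by
    rcases eq_or_ne e p.1 with rfl | hne
    · rw [Function.update_self, Fin.strictMono_iff_lt_succ]
      intro i
      have hmono := P.strictMono p.1
      rcases eq_or_ne i.castSucc p.2.succ.castSucc with hi | hi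
      · have hi' : i = p.2.succ := Fin.castSucc_injective _ hi
        subst hi'
        rw [Function.update_self, Function.update_of_ne (Fin.castSucc_lt_succ).ne']
        exact h₂
      · rw [Function.update_of_ne hi]
        rcases eq_or_ne i.succ p.2.succ.castSucc with hj | hj
        · rw [hj, Function.update_self]
          have : i = p.2.castSucc := by
            rw [← Fin.succ_castSucc] at hj
            exact Fin.succ_injective _ hj
          subst this
          exact h₁
        · rw [Function.update_of_ne hj]
          exact hmono Fin.castSucc_lt_succ
    · rw [Function.update_of_ne hne]
      exact P.strictMono e
  t_zero e := by
    rcases eq_or_ne e p.1 with rfl | hne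
    · rw [Function.update_self, Function.update_of_ne, P.t_zero]
      intro h
      simpa using congrArg Fin.val h
    · rw [Function.update_of_ne hne, P.t_zero]
  t_last e := by
    rcases eq_or_ne e p.1 with rfl | hne
    · rw [Function.update_self, Function.update_of_ne, P.t_last]
      exact (Fin.castSucc_lt_last _).ne'
    · rw [Function.update_of_ne hne, P.t_last]
  sum_n := P.sum_n

section Move

variable [DecidableEq E] (p : P.Vertex) (s : ℝ) (h₁ : P.t p.1 p.2.castSucc.castSucc < s)
    (h₂ : s < P.t p.1 p.2.succ.succ)

theorem pos_move_of_ne {q : P.Vertex} (hq : q ≠ p) :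
    (P.move p s h₁ h₂).pos q = P.pos q := by
  obtain ⟨e, k⟩ := p
  obtain ⟨e', k'⟩ := q
  simp only [pos]
  rcases eq_or_ne e' e with rfl | hne
  · rw [Function.update_self, Function.update_of_ne]
    intro h
    exact hq (by rw [Fin.succ_injective _ (Fin.castSucc_injective _ h)])
  · rw [Function.update_of_ne hne]

theorem pos_move_self : (P.move p s h₁ h₂).pos p = s := by
  simp [pos]

theorem lo_move_of_ne {q : P.Segment} (hq : q ≠ P.rightSegment p) :
    (P.move p s h₁ h₂).divided.lo q = P.divided.lo q := by
  obtain ⟨e, k⟩ := p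
  obtain ⟨e', k'⟩ := q
  simp only [divided]
  rcases eq_or_ne e' e with rfl | hne
  · rw [Function.update_self, Function.update_of_ne]
    intro h
    exact hq (by rw [Fin.castSucc_injective _ h]; rfl)
  · rw [Function.update_of_ne hne]

theorem hi_move_of_ne {q : P.Segment} (hq : q ≠ P.leftSegment p) :
    (P.move p s h₁ h₂).divided.hi q = P.divided.hi q := by
  obtain ⟨e, k⟩ := p
  obtain ⟨e', k'⟩ := q
  simp only [divided]
  rcases eq_or_ne e' e with rfl | hne
  · rw [Function.update_self, Function.update_of_ne]
    intro h
    rw [← Fin.succ_castSucc] at h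
    exact hq (by rw [Fin.succ_injective _ h]; rfl)
  · rw [Function.update_of_ne hne]

theorem lo_move_self : (P.move p s h₁ h₂).divided.lo (P.rightSegment p) = s := by
  simp [divided, rightSegment]

theorem hi_move_self : (P.move p s h₁ h₂).divided.hi (P.leftSegment p) = s := by
  simp [divided, leftSegment]

/-- The subgraphs after moving a partition vertex. -/
def movedSubgraph (j : P.Part) :
    QuantumGraph (V ⊕ P.Vertex) {q : P.Segment // Quotient.mk P.divided.linkSetoid q = j} :=
  (P.move p s h₁ h₂).divided.subgraph j

/-- A move changes coordinates only. The number of points on each edge, the segments, their links,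
and hence the type of parts are definitionally those of `P`, so parts before and after the move can
be compared under the same index. -/
theorem sameData_movedSubgraph (j : P.Part) :
    SameData (P.divided.subgraph j) (P.movedSubgraph p s h₁ h₂ j) := ⟨rfl, rfl, rfl, rfl⟩

theorem lo_movedSubgraph (j : P.Part) (q) :
    (P.movedSubgraph p s h₁ h₂ j).lo q = (P.move p s h₁ h₂).divided.lo q.1 := rfl

theorem hi_movedSubgraph (j : P.Part) (q) :
    (P.movedSubgraph p s h₁ h₂ j).hi q = (P.move p s h₁ h₂).divided.hi q.1 := rfl

open Classical in
theorem partEnergy_move (j : P.Part) :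
    (P.move p s h₁ h₂).partEnergy j = (P.movedSubgraph p s h₁ h₂ j).groundEnergy := rfl

end Move

end Partition

end QuantumGraph

/-! ### Effect of a move on the energies of the parts -/

namespace QuantumGraph

namespace Partition

variable {V E : Type*} [Fintype E] {G : QuantumGraph V E} {m : ℕ} (P : G.Partition m)

theorem nonempty_edges (j : P.Part) :
    Nonempty {q : P.Segment // Quotient.mk P.divided.linkSetoid q = j} := by
  obtain ⟨q, hq⟩ := Quotient.exists_rep j
  exact ⟨⟨q, hq⟩⟩

open Classical in
theorem partEnergy_eq (j : P.Part) :
    P.partEnergy j = (P.divided.subgraph j).groundEnergy := rfl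

theorem isLeast_partEnergy [Finite V] (j : P.Part) :
    IsLeast (P.partEigenvalues j) (P.partEnergy j) := by
  classical
  have := P.nonempty_edges j
  exact isLeast_groundEnergy_and_le.1

section Move

variable [DecidableEq E] (p : P.Vertex) (s : ℝ) (h₁ : P.t p.1 p.2.castSucc.castSucc < s)
    (h₂ : s < P.t p.1 p.2.succ.succ)

/-- Only the two segments at `p` change, and neither belongs to `j`. -/
theorem partEnergy_move_of_ne {j : P.Part} (hl : j ≠ P.partOf (P.leftSegment p))
    (hr : j ≠ P.partOf (P.rightSegment p)) :
    (P.move p s h₁ h₂).partEnergy j = P.partEnergy j := by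
  rw [partEnergy_move, partEnergy_eq, (P.sameData_movedSubgraph p s h₁ h₂ j).eq]
  · funext q
    refine P.lo_move_of_ne p s h₁ h₂ ?_
    intro h
    exact hr (by rw [← q.2, h]; rfl)
  · funext q
    refine P.hi_move_of_ne p s h₁ h₂ ?_
    intro h
    exact hl (by rw [← q.2, h]; rfl)

variable {p s}

/-- Moving the point to the right lengthens the left segment at its Dirichlet end. Since the right
segment lies in another part, nothing in the left part shrinks, and strict monotonicity applies. -/
theorem partEnergy_move_leftSegment_lt [Finite V]
    (hne : P.partOf (P.leftSegment p) ≠ P.partOf (P.rightSegment p)) (hs : P.pos p < s) :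
    (P.move p s h₁ h₂).partEnergy (P.partOf (P.leftSegment p)) <
      P.partEnergy (P.partOf (P.leftSegment p)) := by
  classical
  rw [partEnergy_move, partEnergy_eq]
  have hlo : ∀ q : {q // Quotient.mk P.divided.linkSetoid q = P.partOf (P.leftSegment p)},
      (P.move p s h₁ h₂).divided.lo q.1 = P.divided.lo q.1 := fun q =>
    P.lo_move_of_ne p s h₁ h₂ fun h => hne (by rw [← q.2, h]; rfl)
  refine (P.sameData_movedSubgraph p s h₁ h₂ _).groundEnergy_lt
    (connected_subgraph (P.move p s h₁ h₂).divided _) (fun q => (hlo q).le) (fun q => ?_)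
    (fun q hq => absurd (hlo q) hq.ne) (fun q hq => ?_)
    ⟨⟨P.leftSegment p, rfl⟩, .inr ?_⟩
  · rw [hi_movedSubgraph]
    rcases eq_or_ne q.1 (P.leftSegment p) with h | h
    · rw [h, hi_move_self]
      change P.divided.hi q.1 ≤ s
      rw [h]
      exact hs.le
    · exact (P.hi_move_of_ne p s h₁ h₂ h).ge
  · rcases eq_or_ne q.1 (P.leftSegment p) with h | h
    · change P.divided.coupling (P.divided.tgt q.1) = ⊤
      rw [h, coupling_tgt_leftSegment]
    · exact absurd (P.hi_move_of_ne p s h₁ h₂ h).symm hq.ne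
  · rw [hi_movedSubgraph, hi_move_self]
    exact hs

theorem partEnergy_move_rightSegment_lt [Finite V]
    (hne : P.partOf (P.leftSegment p) ≠ P.partOf (P.rightSegment p)) (hs : s < P.pos p) :
    (P.move p s h₁ h₂).partEnergy (P.partOf (P.rightSegment p)) <
      P.partEnergy (P.partOf (P.rightSegment p)) := by
  classical
  rw [partEnergy_move, partEnergy_eq]
  have hhi : ∀ q : {q // Quotient.mk P.divided.linkSetoid q = P.partOf (P.rightSegment p)},
      (P.move p s h₁ h₂).divided.hi q.1 = P.divided.hi q.1 := fun q =>
    P.hi_move_of_ne p s h₁ h₂ fun h => hne (by rw [← q.2, h]; rfl)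
  refine (P.sameData_movedSubgraph p s h₁ h₂ _).groundEnergy_lt
    (connected_subgraph (P.move p s h₁ h₂).divided _) (fun q => ?_) (fun q => (hhi q).ge)
    (fun q hq => ?_) (fun q hq => absurd (hhi q) hq.ne')
    ⟨⟨P.rightSegment p, rfl⟩, .inl ?_⟩
  · rw [lo_movedSubgraph]
    rcases eq_or_ne q.1 (P.rightSegment p) with h | h
    · rw [h, lo_move_self]
      change s ≤ P.divided.lo q.1
      rw [h]
      exact hs.le
    · exact (P.lo_move_of_ne p s h₁ h₂ h).le
  · rcases eq_or_ne q.1 (P.rightSegment p) with h | h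
    · change P.divided.coupling (P.divided.src q.1) = ⊤
      rw [h, coupling_src_rightSegment]
    · exact absurd (P.lo_move_of_ne p s h₁ h₂ h) hq.ne
  · rw [lo_movedSubgraph, lo_move_self]
    exact hs

/-- The part that gives way only has an edge shortened, because the growing segment lies in another
part. Upper semicontinuity thus keeps its energy below any strict upper bound. -/
theorem exists_partEnergy_move_rightSegment_lt [Finite V]
    (hne : P.partOf (P.leftSegment p) ≠ P.partOf (P.rightSegment p)) {Λ : ℝ}
    (hΛ : P.partEnergy (P.partOf (P.rightSegment p)) < Λ) :
    ∃ δ > 0, ∀ s h₁ h₂, P.pos p ≤ s → s < P.pos p + δ →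
      (P.move p s h₁ h₂).partEnergy (P.partOf (P.rightSegment p)) < Λ := by
  classical
  have := P.nonempty_edges (P.partOf (P.rightSegment p))
  rw [partEnergy_eq] at hΛ
  obtain ⟨δ, hδ, h⟩ := exists_groundEnergy_lt hΛ
  refine ⟨δ, hδ, fun s h₁ h₂ hs hsδ => ?_⟩
  rw [partEnergy_move]
  refine h _ (P.sameData_movedSubgraph p s h₁ h₂ _) (fun q => ?_) (fun q => ?_)
  · rw [lo_movedSubgraph]
    change P.divided.lo q.1 ≤ _ ∧ _ < P.divided.lo q.1 + δ
    rcases eq_or_ne q.1 (P.rightSegment p) with h | h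
    · rw [h, lo_move_self]
      exact ⟨hs, hsδ⟩
    · rw [P.lo_move_of_ne p s h₁ h₂ h]
      exact ⟨le_rfl, lt_add_of_pos_right _ hδ⟩
  · rw [hi_movedSubgraph, P.hi_move_of_ne p s h₁ h₂ fun h => hne (by rw [← q.2, h]; rfl)]
    exact ⟨le_rfl, sub_lt_self _ hδ⟩

theorem exists_partEnergy_move_leftSegment_lt [Finite V]
    (hne : P.partOf (P.leftSegment p) ≠ P.partOf (P.rightSegment p)) {Λ : ℝ}
    (hΛ : P.partEnergy (P.partOf (P.leftSegment p)) < Λ) :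
    ∃ δ > 0, ∀ s h₁ h₂, s ≤ P.pos p → P.pos p - δ < s →
      (P.move p s h₁ h₂).partEnergy (P.partOf (P.leftSegment p)) < Λ := by
  classical
  have := P.nonempty_edges (P.partOf (P.leftSegment p))
  rw [partEnergy_eq] at hΛ
  obtain ⟨δ, hδ, h⟩ := exists_groundEnergy_lt hΛ
  refine ⟨δ, hδ, fun s h₁ h₂ hs hsδ => ?_⟩
  rw [partEnergy_move]
  refine h _ (P.sameData_movedSubgraph p s h₁ h₂ _) (fun q => ?_) (fun q => ?_)
  · rw [lo_movedSubgraph, P.lo_move_of_ne p s h₁ h₂ fun h => hne (by rw [← q.2, h]; rfl)]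
    exact ⟨le_rfl, lt_add_of_pos_right _ hδ⟩
  · rw [hi_movedSubgraph]
    change _ ≤ P.divided.hi q.1 ∧ P.divided.hi q.1 - δ < _
    rcases eq_or_ne q.1 (P.leftSegment p) with h | h
    · rw [h, hi_move_self]
      exact ⟨hs, hsδ⟩
    · rw [P.hi_move_of_ne p s h₁ h₂ h]
      exact ⟨le_rfl, sub_lt_self _ hδ⟩

theorem isNear_move {ε : ℝ} (hε : 0 < ε) (hs : |s - P.pos p| < ε) :
    P.IsNear ε (P.move p s h₁ h₂) := by
  refine ⟨Equiv.refl _, fun q => ⟨rfl, ?_⟩⟩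
  change |(P.move p s h₁ h₂).pos q - P.pos q| < ε
  rcases eq_or_ne q p with rfl | hq
  · rwa [pos_move_self]
  · rw [P.pos_move_of_ne p s h₁ h₂ hq, sub_self, abs_zero]
    exact hε

end Move

/-! ### Propagation through the graph and induction on the number of maximal parts -/

/-- A property of the parts that is preserved across the partition vertices is common to all
parts. -/
theorem forall_iff_of_connected (hG : G.Connected) {X : P.Part → Prop}
    (hX : ∀ p, X (P.partOf (P.leftSegment p)) ↔ X (P.partOf (P.rightSegment p))) (i j : P.Part) :
    X i ↔ X j := by
  have hedge : ∀ e (k : Fin (P.n e + 1)), X (P.partOf ⟨e, k⟩) ↔ X (P.partOf ⟨e, 0⟩) := by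
    intro e k
    induction k using Fin.induction with
    | zero => exact Iff.rfl
    | succ k ih => exact (hX ⟨e, k⟩).symm.trans ih
  have hend : ∀ e v, (G.src e = v ∨ G.tgt e = v) → ∃ k : Fin (P.n e + 1),
      P.divided.src ⟨e, k⟩ = Sum.inl v ∨ P.divided.tgt ⟨e, k⟩ = Sum.inl v := by
    rintro e v (rfl | rfl)
    · exact ⟨0, .inl rfl⟩
    · exact ⟨Fin.last _, .inr (by simp [divided])⟩
  have hlink : ∀ e e', Relation.EqvGen G.Linked e e' →
      (X (P.partOf ⟨e, 0⟩) ↔ X (P.partOf ⟨e', 0⟩)) := by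
    intro e e' h
    induction h with
    | rel e e' h =>
      obtain ⟨v, hv, he, he'⟩ := h
      obtain ⟨k, hk⟩ := hend e v he
      obtain ⟨k', hk'⟩ := hend e' v he'
      -- A non-Dirichlet vertex of `G` keeps its condition in the divided graph, so the end segments
      -- meeting there lie in one part.
      have : P.partOf ⟨e, k⟩ = P.partOf ⟨e', k'⟩ :=
        Quotient.sound (.rel _ _ ⟨Sum.inl v, hv, hk, hk'⟩)
      rw [← hedge e k, ← hedge e' k', this]
    | refl => exact Iff.rfl
    | symm _ _ _ ih => exact ih.symm
    | trans _ _ _ _ _ ih ih' => exact ih.trans ih'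
  obtain ⟨⟨e, k⟩, rfl⟩ := Quotient.exists_rep i
  obtain ⟨⟨e', k'⟩, rfl⟩ := Quotient.exists_rep j
  exact (hedge e k).trans ((hlink e e' (hG e e')).trans (hedge e' k').symm)

theorem partEnergy_le_energy (j : P.Part) : P.partEnergy j ≤ P.energy :=
  le_ciSup (finite_range P.partEnergy).bddAbove j

/-- If the energies of the parts are not all equal, an arbitrarily small move of a partition vertex
lowers the energy of a part of maximal energy, and affects otherwise only a part whose energy
stays below the maximum. -/
theorem exists_isNear_lowering [Finite V] (hG : G.Connected)
    (hne : ∃ j, P.partEnergy j ≠ P.energy) {ε : ℝ} (hε : 0 < ε) :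
    ∃ Q : G.Partition m, P.IsNear ε Q ∧ ∃ φ : P.Part ≃ Q.Part,
      (∃ A, P.partEnergy A = P.energy ∧ Q.partEnergy (φ A) < P.energy) ∧
      ∀ j, Q.partEnergy (φ j) = P.partEnergy j ∨ Q.partEnergy (φ j) < P.energy := by
  classical
  obtain ⟨j, hj⟩ := hne
  have : Nonempty P.Part := ⟨j⟩
  obtain ⟨i, hi⟩ : ∃ i, P.partEnergy i = P.energy := exists_eq_ciSup_of_finite
  have hlt : ∀ j, P.partEnergy j ≠ P.energy → P.partEnergy j < P.energy :=
    fun j hj => lt_of_le_of_ne (P.partEnergy_le_energy j) hj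
  -- If maximality passed across every partition point in both directions, connectedness would make
  -- all parts maximal.
  have hp : ∃ p, ¬(P.partEnergy (P.partOf (P.leftSegment p)) = P.energy ↔
      P.partEnergy (P.partOf (P.rightSegment p)) = P.energy) := by
    by_contra! hcon
    exact hj ((P.forall_iff_of_connected hG (X := fun j => P.partEnergy j = P.energy) hcon i j).1 hi)
  obtain ⟨p, hp⟩ := hp
  have hparts : P.partOf (P.leftSegment p) ≠ P.partOf (P.rightSegment p) := fun h =>
    hp (by rw [h])
  have hL : P.t p.1 p.2.castSucc.castSucc < P.pos p :=
    P.strictMono p.1 (by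
      rw [Fin.castSucc_lt_castSucc_iff]
      exact Fin.castSucc_lt_succ)
  have hR : P.pos p < P.t p.1 p.2.succ.succ := P.strictMono p.1 Fin.castSucc_lt_succ
  by_cases hl : P.partEnergy (P.partOf (P.leftSegment p)) = P.energy
  · have hr : P.partEnergy (P.partOf (P.rightSegment p)) < P.energy :=
      hlt _ fun h => hp (iff_of_true hl h)
    obtain ⟨δ, hδ, hmove⟩ := P.exists_partEnergy_move_rightSegment_lt hparts hr
    -- The bounds on `s` respectively keep it before the next point, keep the right part below the
    -- maximum, and keep the move within `ε`.
    obtain ⟨s, hs, hs'⟩ := exists_between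
      (lt_min (lt_min hR (lt_add_of_pos_right (P.pos p) hδ)) (lt_add_of_pos_right (P.pos p) hε))
    simp only [lt_min_iff] at hs'
    have hA := P.partEnergy_move_leftSegment_lt (hL.trans hs) hs'.1.1 hparts hs
    rw [hl] at hA
    refine ⟨P.move p s (hL.trans hs) hs'.1.1, P.isNear_move _ _ hε ?_, Equiv.refl P.Part,
      ⟨_, hl, hA⟩, fun j => ?_⟩
    · rw [abs_of_pos (sub_pos.2 hs)]
      linarith
    · rcases eq_or_ne j (P.partOf (P.leftSegment p)) with rfl | h1
      · exact .inr hA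
      rcases eq_or_ne j (P.partOf (P.rightSegment p)) with rfl | h2
      · exact .inr (hmove s _ _ hs.le hs'.1.2)
      · exact .inl (P.partEnergy_move_of_ne p s _ _ h1 h2)
  · have hr : P.partEnergy (P.partOf (P.rightSegment p)) = P.energy := by
      by_contra h
      exact hp (iff_of_false hl h)
    obtain ⟨δ, hδ, hmove⟩ := P.exists_partEnergy_move_leftSegment_lt hparts (hlt _ hl)
    obtain ⟨s, hs, hs'⟩ := exists_between
      (max_lt (max_lt hL (sub_lt_self (P.pos p) hδ)) (sub_lt_self (P.pos p) hε))
    simp only [max_lt_iff] at hs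
    have hA := P.partEnergy_move_rightSegment_lt hs.1.1 (hs'.trans hR) hparts hs'
    rw [hr] at hA
    refine ⟨P.move p s hs.1.1 (hs'.trans hR), P.isNear_move _ _ hε ?_, Equiv.refl P.Part,
      ⟨_, hr, hA⟩, fun j => ?_⟩
    · rw [abs_of_neg (sub_neg.2 hs')]
      linarith
    · rcases eq_or_ne j (P.partOf (P.rightSegment p)) with rfl | h1
      · exact .inr hA
      rcases eq_or_ne j (P.partOf (P.leftSegment p)) with rfl | h2
      · exact .inr (hmove s _ _ hs'.le hs.1.2)
      · exact .inl (P.partEnergy_move_of_ne p s _ _ h2 h1)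

theorem IsNear.trans {P Q R : G.Partition m} {ε ε' : ℝ} (h : P.IsNear ε Q) (h' : Q.IsNear ε' R) :
    P.IsNear (ε + ε') R := by
  obtain ⟨σ, hσ⟩ := h
  obtain ⟨τ, hτ⟩ := h'
  refine ⟨σ.trans τ, fun p => ⟨(hτ (σ p)).1.trans (hσ p).1, ?_⟩⟩
  calc |R.pos (τ (σ p)) - P.pos p| ≤ |R.pos (τ (σ p)) - Q.pos (σ p)| + |Q.pos (σ p) - P.pos p| :=
        abs_sub_le _ _ _
    _ < ε + ε' := by linarith [(hτ (σ p)).2, (hσ p).2]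

theorem isEquipartition_iff [Finite V] :
    P.IsEquipartition ↔ ∀ j, P.partEnergy j = P.energy := by
  constructor
  · rintro ⟨μ, hμ⟩ j
    have h : ∀ j, P.partEnergy j = μ := fun j => (P.isLeast_partEnergy j).unique (hμ j)
    have : Nonempty P.Part := ⟨j⟩
    rw [energy, h, funext h, ciSup_const]
  · intro h
    refine ⟨P.energy, fun j => ?_⟩
    rw [← h j]
    exact P.isLeast_partEnergy j

/-- A lowering move within half the radius yields `Q` of the same energy: no part rises above the
maximum, and `P` is minimal. The remaining half makes `Q` a local minimum, so the induction on the
number of maximal parts applies to it. Equality of all energies for `Q` then contradicts the part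
that was strictly lowered. -/
theorem IsLocalMinEnergy.isEquipartition [Finite V] (hG : G.Connected) {P : G.Partition m}
    (hP : P.IsLocalMinEnergy) : P.IsEquipartition := by
  induction hn : {j | P.partEnergy j = P.energy}.ncard using Nat.strong_induction_on
    generalizing P with
  | _ n ih =>
  by_contra hcon
  rw [isEquipartition_iff] at hcon
  push Not at hcon
  obtain ⟨ε, hε, hmin⟩ := hP
  obtain ⟨Q, hQ, φ, ⟨A, hA, hA'⟩, hφ⟩ := P.exists_isNear_lowering hG hcon (half_pos hε)
  have hPQ : P.energy ≤ Q.energy := by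
    refine hmin Q ?_
    obtain ⟨σ, hσ⟩ := hQ
    exact ⟨σ, fun p => ⟨(hσ p).1, (hσ p).2.trans (half_lt_self hε)⟩⟩
  have : Nonempty Q.Part := ⟨φ A⟩
  have hQP : Q.energy = P.energy := by
    refine le_antisymm (ciSup_le fun j => ?_) hPQ
    obtain ⟨j, rfl⟩ := φ.surjective j
    rcases hφ j with h | h
    · exact h.trans_le (P.partEnergy_le_energy j)
    · exact h.le
  have hQmin : Q.IsLocalMinEnergy := by
    refine ⟨ε / 2, half_pos hε, fun R hR => ?_⟩
    rw [hQP]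
    refine hmin R ?_
    have := hQ.trans hR
    rwa [add_halves] at this
  -- No part becomes maximal, because a changed part lies below the maximum, and `A` ceases to be
  -- maximal.
  have hcard : {j | Q.partEnergy j = Q.energy}.ncard < n := by
    rw [← hn, ← ncard_image_of_injective _ φ.injective]
    refine ncard_lt_ncard ⟨?_, fun hsub => ?_⟩ (toFinite _)
    · intro j hj
      obtain ⟨i, rfl⟩ := φ.surjective j
      refine ⟨i, ?_, rfl⟩
      rcases hφ i with h | h
      · rw [mem_ofPred_eq, ← h, ← hQP]
        exact hj
      · exact absurd (hj.trans hQP) h.ne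
    · have : Q.partEnergy (φ A) = Q.energy := hsub ⟨A, hA, rfl⟩
      rw [this, hQP] at hA'
      exact lt_irrefl _ hA'
  have hQe := (Q.isEquipartition_iff).1 (ih _ hcard hQmin rfl) (φ A)
  rw [hQe, hQP] at hA'
  exact lt_irrefl _ hA'

end Partition

end QuantumGraph

theorem theorem1 {V E : Type*} [Finite V] [Fintype E] (G : QuantumGraph V E)
    (hG : G.Connected) (m : ℕ) (P : G.Partition m) (hP : P.IsLocalMinEnergy) :
    P.IsEquipartition := hP.isEquipartition hG
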